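/- Let $H$ be a real separable Hilbert space and let $W=\{W(h):h\in H\}$ be an isonormal Gaussian process over $H$ on a probability space $(\Omega,\mathcal F,\mathbb P)$, i.e. a centered (jointly) Gaussian family with $\mathbb E[W(h)W(k)]=\langle h,k\rangle_H$. Fix $n\ge 1$. Let $I_n$ be the $n$-th multiple Wiener–Itô integral, i.e. the continuous linear map from the symmetric tensors of the Hilbert tensor power $H^{\otimes n}$ to $L^2(\mathbb P)$ with $I_n(h^{\otimes n})=H_n(W(h))$ for $\|h\|_H=1$, where $H_n(x)=(-1)^n e^{x^2/2}\frac{d^n}{dx^n}e^{-x^2/2}$. Let $(f_t)_{0\le t\le1}$ be symmetric elements of $H^{\otimes n}$ and let $(X_t)_{0\le t\le 1}$ be a process with a.s. continuous paths such that $X_t=I_n(f_t)$ a.s. for every $t\in[0,1]$. Write $f_{s,t}=f_t-f_s$ and $X_{s,t}=X_t-X_s$, and let $\|\cdot\|$ be the norm of $H^{\otimes n}$. Assume: 1. (Regularity) $f_0=0$, and there are $C>0$ and $\theta>1$ with $0<\|f_{s,t}\|\le C|t-s|^{\theta/2}$ for all $0\le s<t\le1$. 2. (Kernel form) $0<\beta<1$,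 and for all $m\ge1$, $k,l\ge0$, all nonzero $(a_1,\dots,a_m)\in\mathbb R^m$, all $t_0<t_1<\dots<t_m$ in $[0,1]$, all $s_1<\dots<s_k$ in $[0,t_0)$ and all $r_1<\dots<r_l$ in $(t_m,1]$, the vector $v=\sum_{i=1}^m a_i f_{t_{i-1},t_i}$ satisfies $$\|v-Pv\|^2>\beta\|v\|^2,$$ where $P$ is the orthogonal projection onto the closed linear span of $f_{0,s_1},f_{s_1,s_2},\dots,f_{s_k,t_0},f_{t_m,r_1},f_{r_1,r_2},\dots,f_{r_{l-1},r_l}$ (for $k=0$ the first group is $f_{0,t_0}$; for $l=0$ the second group is empty). 3. (Non-negative row sums) $\langle f_{u,v},f_{s,t}\rangle_{H^{\otimes n}}\ge0$ whenever $[u,v]\subset[s,t]\subset[0,1]$. Let $\rho<\theta/2$, let $\tau>0$ with $\tau+\rho>1$, and let $g:[0,1]\to\mathbb R$ be (deterministic and) $\tau$-Hölder continuous with $$\|g\|_\tau=\sup_{s\ne t}\frac{|g(t)-g(s)|}{|t-s|^\tau}\neq0 .$$ Then, almost surely, the Young integral $\int_0^1 g_t\,dX_t$ (the limit of the tagged Riemann–Stieltjes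 sums as the mesh of the partition tends to $0$) exists, it belongs to $L^2(\mathbb P)$, and at least one of the following holds: $$\mathbb E\Big(\int_0^1 g_t\,dX_t\Big)^2\ \ge\ \frac{\beta}{4}\Big(\sup_{r\in[0,1]}|g_r|\Big)^2\,\mathbb E(X_1)^2,$$ or there is an interval $[a,b]\subset[0,1]$ with $$b-a\ \ge\ \Big(\frac{\sup_{r\in[0,1]}|g_r|}{2\|g\|_\tau}\Big)^{1/\tau} \qquad\text{and}\qquad \mathbb E\Big(\int_0^1 g_t\,dX_t\Big)^2\ \ge\ \frac{\beta}{4}\Big(\sup_{r\in[0,1]}|g_r|\Big)^2\,\mathbb E(X_{a,b})^2 .$$ Here $\mathbb E(Y)^2$ means $\mathbb E[Y^2]$. -/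

import Mathlib

open MeasureTheory ProbabilityTheory Filter Topology
open scoped NNReal ENNReal unitInterval TensorProduct

noncomputable section

/-! ### Hilbert tensor powers -/

/-- The algebraic `n`-th tensor power of a real vector space. (A type synonym, because the
algebraic tensor product already carries a different norm in Mathlib.) -/
def AlgTensorPower (H : Type*) [NormedAddCommGroup H] [InnerProductSpace ℝ H] (n : ℕ) : Type _ :=
  ⨂[ℝ] _ : Fin n, H

namespace AlgTensorPower

variable (H : Type*) [NormedAddCommGroup H] [InnerProductSpace ℝ H] (n : ℕ)

instance : AddCommGroup (AlgTensorPower H n) :=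
  inferInstanceAs (AddCommGroup (⨂[ℝ] _ : Fin n, H))

instance : Module ℝ (AlgTensorPower H n) :=
  inferInstanceAs (Module ℝ (⨂[ℝ] _ : Fin n, H))

/-- The pure tensor `x₁ ⊗ ⋯ ⊗ xₙ`, as a multilinear map. -/
def tprod : MultilinearMap ℝ (fun _ : Fin n => H) (AlgTensorPower H n) :=
  PiTensorProduct.tprod ℝ

/-- The bilinear form with `⟨x₁ ⊗ ⋯ ⊗ xₙ, y₁ ⊗ ⋯ ⊗ yₙ⟩ = ∏ᵢ ⟨xᵢ, yᵢ⟩`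
(see `form_tprod`). -/
def form : AlgTensorPower H n →ₗ[ℝ] AlgTensorPower H n →ₗ[ℝ] ℝ :=
  (PiTensorProduct.dualDistrib : (⨂[ℝ] _ : Fin n, Module.Dual ℝ H) →ₗ[ℝ]
    Module.Dual ℝ (⨂[ℝ] _ : Fin n, H)) ∘ₗ (PiTensorProduct.map fun _ : Fin n => innerₗ H)

variable {H n}

theorem form_tprod (x y : Fin n → H) :
    form H n (tprod H n x) (tprod H n y) = ∏ i, inner ℝ (x i) (y i) := by
  have h : ((PiTensorProduct.dualDistrib : (⨂[ℝ] _ : Fin n, Module.Dual ℝ H) →ₗ[ℝ]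
      Module.Dual ℝ (⨂[ℝ] _ : Fin n, H)) ∘ₗ (PiTensorProduct.map fun _ : Fin n => innerₗ H))
      (PiTensorProduct.tprod ℝ x) (PiTensorProduct.tprod ℝ y) = ∏ i, inner ℝ (x i) (y i) := by
    rw [LinearMap.comp_apply, PiTensorProduct.map_tprod, PiTensorProduct.dualDistrib_apply]
    rfl
  exact h

theorem span_tprod : Submodule.span ℝ (Set.range (tprod H n)) = ⊤ :=
  PiTensorProduct.span_tprod_eq_top

theorem form_symm (u v : AlgTensorPower H n) : form H n u v = form H n v u := by
  have key : form H n = (form H n).flip := by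
    apply LinearMap.ext_on_range (v := tprod H n) span_tprod
    intro x
    apply LinearMap.ext_on_range (v := tprod H n) span_tprod
    intro y
    rw [LinearMap.flip_apply, form_tprod, form_tprod]
    exact Finset.prod_congr rfl fun i _ => (real_inner_comm _ _)
  exact congrArg (fun B => B u v) key

theorem posSemidef_prod_gram {m : ℕ} (v : Fin m → Fin n → H) (s : Finset (Fin n)) :
    (Matrix.of fun i j : Fin m => ∏ k ∈ s, inner ℝ (v i k) (v j k)).PosSemidef := by
  classical
  induction s using Finset.induction_on with
  | empty =>
    have e : (Matrix.of fun i j : Fin m => ∏ k ∈ (∅ : Finset (Fin n)), inner ℝ (v i k) (v j k))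
        = Matrix.gram ℝ (fun _ : Fin m => (1 : ℝ)) := by
      ext i j
      simp [Matrix.gram]
    rw [e]
    exact Matrix.posSemidef_gram ℝ (fun _ : Fin m => (1 : ℝ))
  | insert a s ha ih =>
    have e : (Matrix.of fun i j : Fin m => ∏ k ∈ insert a s, inner ℝ (v i k) (v j k))
        = (Matrix.gram ℝ (fun i : Fin m => v i a)).hadamard
          (Matrix.of fun i j : Fin m => ∏ k ∈ s, inner ℝ (v i k) (v j k)) := by
      ext i j
      simp [Matrix.gram, Finset.prod_insert ha]
    rw [e]
    exact (Matrix.posSemidef_gram ℝ (fun i : Fin m => v i a)).hadamard ih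

theorem form_self_nonneg (u : AlgTensorPower H n) : 0 ≤ form H n u u := by
  have hu : u ∈ Submodule.span ℝ (Set.range (tprod H n)) := by rw [span_tprod]; trivial
  obtain ⟨m, c, w, rfl⟩ := Submodule.mem_span_set'.1 hu
  choose v hv using fun i => (w i).2
  have h := (Matrix.posSemidef_iff_dotProduct_mulVec.1
    (posSemidef_prod_gram v Finset.univ)).2 c
  have e : form H n (∑ i, c i • (w i : AlgTensorPower H n))
      (∑ i, c i • (w i : AlgTensorPower H n))
      = ∑ i, c i * ∑ j, (∏ k, inner ℝ (v i k) (v j k)) * c j := by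
    simp only [← hv, map_sum, map_smul, LinearMap.sum_apply, LinearMap.smul_apply, form_tprod,
      smul_eq_mul, Finset.mul_sum]
    rw [Finset.sum_comm]
    exact Finset.sum_congr rfl fun i _ => Finset.sum_congr rfl fun j _ => by ring
  rw [e]
  simpa [dotProduct, Matrix.mulVec] using h

variable (H n)

/-- The (pre-)inner product of the algebraic tensor power. -/
@[reducible]
def core : PreInnerProductSpace.Core ℝ (AlgTensorPower H n) where
  inner u v := form H n u v
  conj_inner_symm u v := form_symm v u
  re_inner_nonneg u := form_self_nonneg u
  add_left u v w := by simp
  smul_left u v r := by simp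

instance : SeminormedAddCommGroup (AlgTensorPower H n) :=
  @InnerProductSpace.Core.toSeminormedAddCommGroup ℝ _ _ _ _ (core H n)

instance : InnerProductSpace ℝ (AlgTensorPower H n) :=
  InnerProductSpace.ofCore (core H n)

end AlgTensorPower

/-- The Hilbert space `H^{⊗n}`: the completion of the algebraic tensor power with respect to
the inner product `⟨x₁ ⊗ ⋯ ⊗ xₙ, y₁ ⊗ ⋯ ⊗ yₙ⟩ = ∏ᵢ ⟨xᵢ, yᵢ⟩`. -/
abbrev HilbertTensorPower (H : Type*) [NormedAddCommGroup H] [InnerProductSpace ℝ H] (n : ℕ) :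
    Type _ :=
  UniformSpace.Completion (AlgTensorPower H n)

section Wiener

variable {H : Type*} [NormedAddCommGroup H] [InnerProductSpace ℝ H]

/-- The pure tensor `x₁ ⊗ ⋯ ⊗ xₙ` in `H^{⊗n}`. -/
def hilbertTprod {n : ℕ} (x : Fin n → H) : HilbertTensorPower H n :=
  ((AlgTensorPower.tprod H n x : AlgTensorPower H n) : HilbertTensorPower H n)

theorem inner_hilbertTprod {n : ℕ} (x y : Fin n → H) :
    inner ℝ (hilbertTprod x) (hilbertTprod y) = ∏ i, inner ℝ (x i) (y i) := by
  unfold hilbertTprod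
  rw [UniformSpace.Completion.inner_coe]
  exact AlgTensorPower.form_tprod x y

/-! ### Isonormal Gaussian processes and multiple Wiener–Itô integrals -/

variable {Ω : Type*} [MeasurableSpace Ω]

/-- `W` is an isonormal Gaussian process over `H`: a centered (jointly) Gaussian family indexed
by `H` with `E[W(h) W(g)] = ⟨h, g⟩`. -/
structure IsIsonormalGaussian (W : H → Ω → ℝ) (P : Measure Ω) : Prop where
  isGaussianProcess : IsGaussianProcess W P
  centered : ∀ h, ∫ ω, W h ω ∂P = 0
  covariance : ∀ h g, ∫ ω, W h ω * W g ω ∂P = inner ℝ h g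

/-- The graph of the multiple Wiener–Itô integral `Iₙ`. On the tensors `h^{⊗n}` with `‖h‖ = 1`,
`Iₙ(h^{⊗n}) = Hₙ(W(h))` with `Hₙ` the `n`-th (probabilists') Hermite polynomial; `Iₙ` is extended
by linearity and `L²`-convergence. Its domain is the closed linear span of the `h^{⊗n}`,
that is, the space of symmetric tensors. -/
def multipleIntegralGraph (W : H → Ω → ℝ) (P : Measure Ω) (n : ℕ) :
    Submodule ℝ (HilbertTensorPower H n × Lp ℝ 2 P) :=
  (Submodule.span ℝ {p : HilbertTensorPower H n × Lp ℝ 2 P |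
    ∃ h : H, ‖h‖ = 1 ∧ p.1 = hilbertTprod (fun _ : Fin n => h) ∧
      p.2 =ᵐ[P] fun ω => Polynomial.aeval (W h ω) (Polynomial.hermite n)}).topologicalClosure

/-- `Y = Iₙ(f)` almost surely (so `f` is symmetric, and `Y` is square integrable). -/
def IsMultipleIntegral (W : H → Ω → ℝ) (P : Measure Ω) (n : ℕ) (f : HilbertTensorPower H n)
    (Y : Ω → ℝ) : Prop :=
  ∃ hY : MemLp Y 2 P, (f, hY.toLp Y) ∈ multipleIntegralGraph W P n

end Wiener

/-! ### Assumptions on the kernels -/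

section Kernel

variable {E : Type*} [NormedAddCommGroup E] [InnerProductSpace ℝ E]

/-- Regularity of the kernels, with exponent `θ`. -/
def KernelRegularity (f : I → E) (θ : ℝ) : Prop :=
  1 < θ ∧ f 0 = 0 ∧ ∃ C : ℝ, 0 < C ∧ ∀ s t : I, s < t →
    0 < ‖f t - f s‖ ∧ ‖f t - f s‖ ≤ C * ((t : ℝ) - s) ^ (θ / 2)

/-- The increments `f_{p₀,p₁}, …, f_{p_{k-1},p_k}` of `f` along `p₀, …, p_k`. -/
def incrementsAlong (f : I → E) {k : ℕ} (p : Fin (k + 1) → I) : Set E :=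
  Set.range fun i : Fin k => f (p i.succ) - f (p i.castSucc)

/-- The span of `f_{0,s₁}, …, f_{s_k,u}` and `f_{v,r₁}, …, f_{r_{l-1},r_l}`. -/
def outerSpan (f : I → E) {k l : ℕ} (s : Fin k → I) (u v : I) (r : Fin l → I) :
    Submodule ℝ E :=
  Submodule.span ℝ
    (incrementsAlong f (Fin.cons 0 (Fin.snoc s u : Fin (k + 1) → I) : Fin (k + 2) → I) ∪
      incrementsAlong f (Fin.cons v r : Fin (l + 1) → I))

/-- The kernel form of the non-determinism condition, with constant `β`: a nontrivial linear
combination of the increments over `t₀ < ⋯ < t_m` keeps a fraction larger than `β` of its squared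
norm after subtracting its projection onto the closed span of increments outside `[t₀, t_m]`. -/
def KernelForm [CompleteSpace E] (f : I → E) (β : ℝ) : Prop :=
  ∀ (m k l : ℕ) (a : Fin m → ℝ) (t : Fin (m + 1) → I) (s : Fin k → I) (r : Fin l → I),
    a ≠ 0 → StrictMono t → StrictMono s → StrictMono r →
    (∀ i, s i < t 0) → (∀ i, t (Fin.last m) < r i) →
    β * ‖∑ i, a i • (f (t i.succ) - f (t i.castSucc))‖ ^ 2 <
      ‖(∑ i, a i • (f (t i.succ) - f (t i.castSucc))) -
        (outerSpan f s (t 0) (t (Fin.last m)) r).topologicalClosure.starProjection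
          (∑ i, a i • (f (t i.succ) - f (t i.castSucc)))‖ ^ 2

/-- `⟨f_v - f_u, f_t - f_s⟩ ≥ 0` whenever `[u, v] ⊆ [s, t] ⊆ [0, 1]`. -/
def NonnegRowSum (f : I → E) : Prop :=
  ∀ s u v t : I, s ≤ u → u ≤ v → v ≤ t → 0 ≤ inner ℝ (f v - f u) (f t - f s)

end Kernel

/-! ### The Young integral -/

/-- `J = ∫₀¹ g dx` as a Young integral: the tagged Riemann–Stieltjes sums
`∑ g(ξᵢ) (x(tᵢ₊₁) - x(tᵢ))`, `tᵢ ≤ ξᵢ ≤ tᵢ₊₁`, over partitions of `[0, 1]` converge to `J` as the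
mesh tends to `0`. -/
def HasYoungIntegral (g x : I → ℝ) (J : ℝ) : Prop :=
  ∀ ε > 0, ∃ δ > 0, ∀ (N : ℕ) (t : Fin (N + 1) → I) (ξ : Fin N → I),
    Monotone t → t 0 = 0 → t (Fin.last N) = 1 →
    (∀ i : Fin N, t i.castSucc ≤ ξ i ∧ ξ i ≤ t i.succ) →
    (∀ i : Fin N, (t i.succ : ℝ) - t i.castSucc < δ) →
    |(∑ i : Fin N, g (ξ i) * (x (t i.succ) - x (t i.castSucc))) - J| < ε

open Classical in
/-- The Young integral `∫₀¹ g dx` (`0` if it does not exist). -/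
def youngIntegral (g x : I → ℝ) : ℝ :=
  if h : ∃ J, HasYoungIntegral g x J then h.choose else 0

end

/-!
Multiple integrals enter only through the isometry `E[I_n(f) I_n(f')] = n! ⟪f, f'⟫`, which comes
from Mehler's formula for products of Hermite polynomials of two correlated Gaussians. Hence a
second moment of the integral is `n!` times the squared norm of the limit `Z` of the vector-valued
sums `∑ g_{t_k} f_{t_k, t_{k+1}}` over dyadic partitions.

Pathwise, `E ‖X_{s,t}‖ ^ 2 ≲ |t - s| ^ θ` gives, almost surely, a summable weighted dyadic energy of
`X`. By Cauchy–Schwarz this energy controls the defect `g_{s,u} X_{u,t}` although the paths need not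
be Hölder continuous of exponent `> 1 - τ`, and the sewing argument produces the Young integral,
which agrees with the `L²` limit of the dyadic sums.

For the lower bound let `|g|` be maximal at `r`, with `g r > 0`. By Hölder continuity `g ≥ g r / 2`
on all of `[0, 1]` or on an interval `[a, b]` of the asserted length. The kernel form discards, at
the price of `β`, the increments outside the interval; inside it, nonnegative row sums allow the
weights `g_{t_k}` to be replaced by the constant `g r / 2`.
-/

noncomputable section

/-! ### Controls and sewing -/

/-- A control on a preorder: a nonnegative superadditive function of the interval `[s, t]`.
No continuity is required, and nothing is required of the values with `¬ s ≤ t`. -/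
structure IsControl {ι : Type*} [Preorder ι] (ω : ι → ι → ℝ) : Prop where
  nonneg : ∀ ⦃s t⦄, s ≤ t → 0 ≤ ω s t
  add_le : ∀ ⦃s u t⦄, s ≤ u → u ≤ t → ω s u + ω u t ≤ ω s t

namespace IsControl

section Preorder

variable {ι : Type*} [Preorder ι] {ω : ι → ι → ℝ}

theorem self_eq_zero (hω : IsControl ω) (s : ι) : ω s s = 0 := by
  linarith [hω.nonneg (le_refl s), hω.add_le (le_refl s) (le_refl s)]

theorem mono (hω : IsControl ω) {s s' t' t : ι} (hs : s ≤ s') (hst : s' ≤ t') (ht : t' ≤ t) :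
    ω s' t' ≤ ω s t := by
  linarith [hω.add_le hs (hst.trans ht), hω.add_le hst ht, hω.nonneg hs, hω.nonneg ht]

theorem comp {κ : Type*} [Preorder κ] (hω : IsControl ω) {p : κ → ι} (hp : Monotone p) :
    IsControl fun i j => ω (p i) (p j) where
  nonneg _ _ h := hω.nonneg (hp h)
  add_le _ _ _ h₁ h₂ := hω.add_le (hp h₁) (hp h₂)

theorem add {ω' : ι → ι → ℝ} (hω : IsControl ω) (hω' : IsControl ω') :
    IsControl fun s t => ω s t + ω' s t where
  nonneg _ _ h := add_nonneg (hω.nonneg h) (hω'.nonneg h)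
  add_le _ _ _ h₁ h₂ := by linarith [hω.add_le h₁ h₂, hω'.add_le h₁ h₂]

theorem sum_le (hω : IsControl ω) {N : ℕ} {t : Fin (N + 1) → ι} (ht : Monotone t) :
    ∑ i : Fin N, ω (t i.castSucc) (t i.succ) ≤ ω (t 0) (t (Fin.last N)) := by
  induction N with
  | zero => simpa using hω.nonneg (le_refl (t 0))
  | succ N ih =>
    rw [Fin.sum_univ_castSucc]
    have := ih (ht.comp Fin.strictMono_castSucc.monotone)
    exact (add_le_add_left this _).trans
      (hω.add_le (ht (Fin.zero_le _)) (ht (Fin.castSucc_lt_succ).le))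

theorem sum_rpow_le (hω : IsControl ω) {a η : ℝ} (ha : 1 ≤ a) {N : ℕ} {t : Fin (N + 1) → ι}
    (ht : Monotone t) (hη : ∀ i : Fin N, ω (t i.castSucc) (t i.succ) ≤ η) :
    ∑ i : Fin N, ω (t i.castSucc) (t i.succ) ^ a
      ≤ η ^ (a - 1) * ω (t 0) (t (Fin.last N)) := by
  calc ∑ i : Fin N, ω (t i.castSucc) (t i.succ) ^ a
      ≤ ∑ i : Fin N, η ^ (a - 1) * ω (t i.castSucc) (t i.succ) := by
        refine Finset.sum_le_sum fun i _ => ?_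
        have h0 : 0 ≤ ω (t i.castSucc) (t i.succ) := hω.nonneg (ht Fin.castSucc_lt_succ.le)
        calc ω (t i.castSucc) (t i.succ) ^ a
            = ω (t i.castSucc) (t i.succ) ^ (a - 1) * ω (t i.castSucc) (t i.succ) ^ (1 : ℝ) := by
              rw [← Real.rpow_add_of_nonneg h0 (by linarith) zero_le_one, sub_add_cancel]
          _ ≤ η ^ (a - 1) * ω (t i.castSucc) (t i.succ) := by
              rw [Real.rpow_one]
              gcongr
              exact hη i
    _ ≤ η ^ (a - 1) * ω (t 0) (t (Fin.last N)) := by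
        rw [← Finset.mul_sum]
        rcases N.eq_zero_or_pos with rfl | hN
        · simp [hω.self_eq_zero]
        · have : 0 ≤ η := (hω.nonneg (ht Fin.castSucc_lt_succ.le)).trans (hη ⟨0, hN⟩)
          gcongr
          exact hω.sum_le ht

theorem abs_sub_mul_sub_le (hω : IsControl ω) {g x : ι → ℝ} {L C p q : ℝ}
    (hL : 0 ≤ L) (hC : 0 ≤ C) (hp : 0 ≤ p) (hq : 0 ≤ q)
    (hg : ∀ s t, s ≤ t → |g t - g s| ≤ L * ω s t ^ p)
    (hx : ∀ s t, s ≤ t → |x t - x s| ≤ C * ω s t ^ q)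
    {s u v t y : ι} (hsu : s ≤ u) (huv : u ≤ v) (hvt : v ≤ t) (hsy : s ≤ y) (hyt : y ≤ t) :
    |(g y - g s) * (x v - x u)| ≤ L * C * ω s t ^ (p + q) := by
  have hst : 0 ≤ ω s t := hω.nonneg (hsy.trans hyt)
  rw [abs_mul, Real.rpow_add_of_nonneg hst hp hq, mul_mul_mul_comm]
  refine mul_le_mul ((hg s y hsy).trans ?_) ((hx u v huv).trans ?_) (abs_nonneg _) (by positivity)
  · exact mul_le_mul_of_nonneg_left
      (Real.rpow_le_rpow (hω.nonneg hsy) (hω.mono le_rfl hsy hyt) hp) hL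
  · exact mul_le_mul_of_nonneg_left
      (Real.rpow_le_rpow (hω.nonneg huv) (hω.mono hsu huv hvt) hq) hC

end Preorder

theorem exists_halving {ω : ℕ → ℕ → ℝ} (hω : IsControl ω) {p q : ℕ} (hpq : p < q) :
    ∃ j, p ≤ j ∧ j < q ∧ ω p j ≤ ω p q / 2 ∧ ω (j + 1) q ≤ ω p q / 2 := by
  by_contra! hne
  have left_le : ∀ j, p ≤ j → j ≤ q → ω p j ≤ ω p q / 2 := fun j hpj => by
    induction j, hpj using Nat.le_induction with
    | base => intro _; linarith [hω.self_eq_zero p, hω.nonneg hpq.le]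
    | succ j hpj ih =>
      intro hjq
      linarith [hne j hpj hjq (ih (by omega)), hω.add_le (hpj.trans j.le_succ) hjq]
  obtain ⟨j, rfl⟩ : ∃ j, q = j + 1 := ⟨q - 1, by omega⟩
  linarith [hne j (by omega) (by omega) (left_le j (by omega) (by omega)),
    hω.self_eq_zero (j + 1), hω.nonneg hpq.le]

theorem norm_sum_Ico_sub_le {E : Type*} [SeminormedAddCommGroup E] {ω : ℕ → ℕ → ℝ}
    (hω : IsControl ω) {Ξ : ℕ → ℕ → E} {K a : ℝ} (ha : 1 < a) (hK : 0 ≤ K)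
    (hΞ : ∀ s u t, s ≤ u → u ≤ t → ‖Ξ s t - Ξ s u - Ξ u t‖ ≤ K * ω s t ^ a)
    {p q : ℕ} (hpq : p ≤ q) :
    ‖∑ k ∈ Finset.Ico p q, Ξ k (k + 1) - Ξ p q‖ ≤ 2 * K / (1 - 2 ^ (1 - a)) * ω p q ^ a := by
  have hr : (2 : ℝ) ^ (1 - a) < 1 := Real.rpow_lt_one_of_one_lt_of_neg one_lt_two (by linarith)
  set C := 2 * K / (1 - 2 ^ (1 - a)) with hC
  have hC0 : 0 ≤ C := div_nonneg (by linarith) (by linarith)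
  induction hd : q - p using Nat.strong_induction_on generalizing p q with
  | _ d ih =>
  rcases hpq.eq_or_lt with rfl | hlt
  · have := hΞ p p p le_rfl le_rfl
    rw [hω.self_eq_zero, Real.zero_rpow (by linarith)] at this ⊢
    simpa using this
  obtain ⟨j, hpj, hjq, hleft, hright⟩ := hω.exists_halving hlt
  have hhalf : 2 * (ω p q / 2) ^ a = 2 ^ (1 - a) * ω p q ^ a := by
    rw [Real.div_rpow (hω.nonneg hpq) two_pos.le, Real.rpow_sub two_pos, Real.rpow_one]
    ring
  have ihl := (ih (j - p) (by omega) hpj rfl).trans <| mul_le_mul_of_nonneg_left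
    (Real.rpow_le_rpow (hω.nonneg hpj) hleft (by linarith)) hC0
  have ihr := (ih (q - (j + 1)) (by omega) hjq rfl).trans <| mul_le_mul_of_nonneg_left
    (Real.rpow_le_rpow (hω.nonneg hjq) hright (by linarith)) hC0
  have defect_right : ‖Ξ j q - Ξ j (j + 1) - Ξ (j + 1) q‖ ≤ K * ω p q ^ a :=
    (hΞ _ _ _ j.le_succ hjq).trans <| mul_le_mul_of_nonneg_left
      (Real.rpow_le_rpow (hω.nonneg hjq.le) (hω.mono hpj hjq.le le_rfl) (by linarith)) hK
  rw [← Finset.sum_Ico_consecutive _ hpj hjq.le, Finset.sum_eq_sum_Ico_succ_bot hjq]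
  calc ‖∑ k ∈ Finset.Ico p j, Ξ k (k + 1)
          + (Ξ j (j + 1) + ∑ k ∈ Finset.Ico (j + 1) q, Ξ k (k + 1)) - Ξ p q‖
      = ‖(∑ k ∈ Finset.Ico p j, Ξ k (k + 1) - Ξ p j)
          + (∑ k ∈ Finset.Ico (j + 1) q, Ξ k (k + 1) - Ξ (j + 1) q)
          - ((Ξ p q - Ξ p j - Ξ j q) + (Ξ j q - Ξ j (j + 1) - Ξ (j + 1) q))‖ := by
        congr 1; abel
    _ ≤ (C * (ω p q / 2) ^ a + C * (ω p q / 2) ^ a) + (K * ω p q ^ a + K * ω p q ^ a) :=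
        norm_sub_le_of_le (norm_add_le_of_le ihl ihr)
          (norm_add_le_of_le (hΞ _ _ _ hpj hjq.le) defect_right)
    _ = (C * 2 ^ (1 - a) + 2 * K) * ω p q ^ a := by
        linear_combination C * hhalf
    _ = C * ω p q ^ a := by
        rw [hC]
        field_simp [show (1 : ℝ) - 2 ^ (1 - a) ≠ 0 by linarith]
        ring

section LinearOrder

variable {ι : Type*} [LinearOrder ι] [OrderBot ι] {ω : ι → ι → ℝ}
  {E : Type*} [NormedAddCommGroup E] {Ξ : ι → ι → E} {K a : ℝ}

theorem exists_sewing_on_finset (hω : IsControl ω) (ha : 1 < a) (hK : 0 ≤ K)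
    (hΞ : ∀ s u t, s ≤ u → u ≤ t → ‖Ξ s t - Ξ s u - Ξ u t‖ ≤ K * ω s t ^ a)
    (D : Finset ι) :
    ∃ A : ι → E, A ⊥ = 0 ∧ ∀ s ∈ D, ∀ t ∈ D, s ≤ t →
      ‖A t - A s - Ξ s t‖ ≤ 2 * K / (1 - 2 ^ (1 - a)) * ω s t ^ a := by
  obtain ⟨p, hp, hpD⟩ : ∃ p : ℕ → ι, Monotone p ∧ ∀ t ∈ D, ∃ k, p k = t := by
    rcases D.eq_empty_or_nonempty with rfl | hD
    · exact ⟨fun _ => ⊥, monotone_const, by simp⟩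
    · have hcard : D.card = D.card - 1 + 1 := by have := hD.card_pos; omega
      refine ⟨fun k => D.orderEmbOfFin hcard (Fin.clamp k (D.card - 1)), fun i j hij => ?_,
        fun t ht => ?_⟩
      · exact (D.orderEmbOfFin hcard).monotone (min_le_min_right _ hij)
      · obtain ⟨k, rfl⟩ : t ∈ Set.range (D.orderEmbOfFin hcard) := by simpa using ht
        exact ⟨k, congrArg _ (Fin.ext (min_eq_left (Nat.lt_succ_iff.1 k.2)))⟩
  choose! idx hidx using hpD
  let A : ι → E := fun t => ∑ k ∈ Finset.range (idx t), Ξ (p k) (p (k + 1))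
  refine ⟨fun t => A t - A ⊥, sub_self _, fun s hs t ht hst => ?_⟩
  have hle : idx s ≤ idx t := by
    by_contra! hlt
    have := hp hlt.le
    rw [hidx s hs, hidx t ht] at this
    rw [hst.antisymm this] at hlt
    exact hlt.false
  have := (hω.comp hp).norm_sum_Ico_sub_le ha hK
    (fun i j k hij hjk => hΞ (p i) (p j) (p k) (hp hij) (hp hjk)) hle
  rw [hidx s hs, hidx t ht, Finset.sum_Ico_eq_sub _ hle] at this
  rwa [sub_sub_sub_cancel_right]

/-- The sewing lemma. Existence follows from compactness: an ultrafilter limit of the solutions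
on finite subsets. -/
theorem exists_sewing [ProperSpace E] (hω : IsControl ω) (ha : 1 < a) (hK : 0 ≤ K)
    (hΞ : ∀ s u t, s ≤ u → u ≤ t → ‖Ξ s t - Ξ s u - Ξ u t‖ ≤ K * ω s t ^ a) :
    ∃ A : ι → E, ∀ s t, s ≤ t →
      ‖A t - A s - Ξ s t‖ ≤ 2 * K / (1 - 2 ^ (1 - a)) * ω s t ^ a := by
  choose A hA0 hA using hω.exists_sewing_on_finset ha hK hΞ
  let U : Ultrafilter (Finset ι) := Ultrafilter.of atTop
  have mem_eventually (t : ι) : ∀ᶠ D in (U : Filter (Finset ι)), t ∈ D :=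
    Ultrafilter.of_le atTop ((eventually_ge_atTop {t}).mono fun D hD => hD (by simp))
  have hlim (t : ι) : ∃ y, Tendsto (fun D => A D t) U (𝓝 y) := by
    have hball : ∀ᶠ D in (U : Filter (Finset ι)), A D t ∈ Metric.closedBall (Ξ ⊥ t)
        (2 * K / (1 - 2 ^ (1 - a)) * ω ⊥ t ^ a) := by
      filter_upwards [mem_eventually ⊥, mem_eventually t] with D hbot ht
      simpa [hA0, dist_eq_norm] using hA D ⊥ hbot t ht bot_le
    obtain ⟨y, -, hy⟩ := (isCompact_closedBall (Ξ ⊥ t) _).ultrafilter_le_nhds'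
      (U.map fun D => A D t) hball
    exact ⟨y, hy⟩
  choose B hB using hlim
  refine ⟨B, fun s t hst => ?_⟩
  refine le_of_tendsto (((hB t).sub (hB s)).sub_const _).norm ?_
  filter_upwards [mem_eventually s, mem_eventually t] with D hs ht using hA D s hs t ht hst

end LinearOrder

theorem hasYoungIntegral_of_abs_sub_le {ω : I → I → ℝ} (hω : IsControl ω)
    (hsmall : ∀ η > 0, ∃ δ > 0, ∀ s t : I, s ≤ t → (t : ℝ) - s < δ → ω s t < η)
    {g x A : I → ℝ} {M a : ℝ} (hM : 0 ≤ M) (ha : 1 < a)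
    (hA : ∀ s y t, s ≤ y → y ≤ t → |g y * (x t - x s) - (A t - A s)| ≤ M * ω s t ^ a) :
    HasYoungIntegral g x (A 1 - A 0) := by
  intro ε hε
  obtain ⟨η, hη, hηε⟩ : ∃ η > 0, M * (η ^ (a - 1) * ω 0 1) < ε := by
    have : Tendsto (fun η : ℝ => M * (η ^ (a - 1) * ω 0 1)) (𝓝[>] 0) (𝓝 0) := by
      have h := ((Real.continuousAt_rpow_const 0 (a - 1) (Or.inr (by linarith))).mul_const
        (ω 0 1)).const_mul M |>.tendsto
      rw [Real.zero_rpow (by linarith), zero_mul, mul_zero] at h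
      exact h.mono_left nhdsWithin_le_nhds
    exact (eventually_mem_nhdsWithin.and (this.eventually_lt_const hε)).exists
  obtain ⟨δ, hδ, hωδ⟩ := hsmall η hη
  refine ⟨δ, hδ, fun N t ξ ht ht0 ht1 hξ hmesh => lt_of_le_of_lt ?_ hηε⟩
  have hstep (i : Fin N) : t i.castSucc ≤ t i.succ := ht Fin.castSucc_lt_succ.le
  have htelescope : A 1 - A 0 = ∑ i : Fin N, (A (t i.succ) - A (t i.castSucc)) := by
    rw [Finset.sum_sub_distrib, ← ht0, ← ht1, ← add_right_inj (A (t 0)), ← add_sub_assoc,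
      ← add_sub_assoc, ← Fin.sum_univ_succ fun i => A (t i), Fin.sum_univ_castSucc]
    ring
  calc |∑ i : Fin N, g (ξ i) * (x (t i.succ) - x (t i.castSucc)) - (A 1 - A 0)|
      ≤ ∑ i : Fin N, M * ω (t i.castSucc) (t i.succ) ^ a := by
        rw [htelescope, ← Finset.sum_sub_distrib]
        exact (Finset.abs_sum_le_sum_abs _ _).trans
          (Finset.sum_le_sum fun i _ => hA _ _ _ (hξ i).1 (hξ i).2)
    _ ≤ M * (η ^ (a - 1) * ω 0 1) := by
        rw [← Finset.mul_sum, ← ht0, ← ht1]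
        exact mul_le_mul_of_nonneg_left
          (hω.sum_rpow_le ha.le ht fun i => (hωδ _ _ (hstep i) (hmesh i)).le) hM

theorem exists_hasYoungIntegral {ω : I → I → ℝ} (hω : IsControl ω)
    (hsmall : ∀ η > 0, ∃ δ > 0, ∀ s t : I, s ≤ t → (t : ℝ) - s < δ → ω s t < η)
    {g x : I → ℝ} {L C p q : ℝ} (hL : 0 ≤ L) (hC : 0 ≤ C) (hp : 0 ≤ p) (hq : 0 ≤ q)
    (hpq : 1 < p + q) (hg : ∀ s t, s ≤ t → |g t - g s| ≤ L * ω s t ^ p)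
    (hx : ∀ s t, s ≤ t → |x t - x s| ≤ C * ω s t ^ q) :
    ∃ J, HasYoungIntegral g x J := by
  obtain ⟨A, hA⟩ := hω.exists_sewing (Ξ := fun s t => g s * (x t - x s)) hpq (mul_nonneg hL hC)
    fun s u t hsu hut => by
      rw [Real.norm_eq_abs, ← abs_neg, show -(g s * (x t - x s) - g s * (x u - x s)
        - g u * (x t - x u)) = (g u - g s) * (x t - x u) by ring]
      exact hω.abs_sub_mul_sub_le hL hC hp hq hg hx hsu hut le_rfl hsu hut
  have hrpow : (2 : ℝ) ^ (1 - (p + q)) < 1 :=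
    Real.rpow_lt_one_of_one_lt_of_neg one_lt_two (by linarith)
  refine ⟨A 1 - A 0, hω.hasYoungIntegral_of_abs_sub_le hsmall
    (M := 2 * (L * C) / (1 - 2 ^ (1 - (p + q))) + L * C)
    (add_nonneg (div_nonneg (by positivity) (by linarith)) (by positivity)) hpq
    fun s y t hsy hyt => ?_⟩
  have hst := hsy.trans hyt
  have hsewing := abs_le.1 (hA s t hst)
  have htag := abs_le.1
    (hω.abs_sub_mul_sub_le hL hC hp hq hg hx le_rfl hst le_rfl hsy hyt)
  exact abs_le.2 ⟨by linarith, by linarith⟩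

end IsControl

/-! ### Dyadic points and dyadic Riemann–Stieltjes sums -/

/-- The dyadic point `k / 2 ^ n` of the unit interval; it is `1` for all `k ≥ 2 ^ n`. -/
def dyadicPoint (n k : ℕ) : I := Set.projIcc 0 1 zero_le_one ((k : ℝ) / 2 ^ n)

theorem coe_dyadicPoint {n k : ℕ} (hk : k ≤ 2 ^ n) : (dyadicPoint n k : ℝ) = k / 2 ^ n := by
  have hmem : (k : ℝ) / 2 ^ n ∈ Set.Icc (0 : ℝ) 1 :=
    ⟨by positivity, (div_le_one (by positivity)).2 (by exact_mod_cast hk)⟩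
  rw [dyadicPoint, Set.projIcc_of_mem zero_le_one hmem]

@[simp]
theorem dyadicPoint_zero (n : ℕ) : dyadicPoint n 0 = 0 :=
  Subtype.ext (by simp [coe_dyadicPoint])

@[simp]
theorem dyadicPoint_two_pow (n : ℕ) : dyadicPoint n (2 ^ n) = 1 :=
  Subtype.ext (by simp [coe_dyadicPoint])

theorem dyadicPoint_two_mul (n k : ℕ) : dyadicPoint (n + 1) (2 * k) = dyadicPoint n k := by
  unfold dyadicPoint
  congr 1
  push_cast
  rw [pow_succ, mul_comm (2 : ℝ) k, mul_div_mul_right _ _ two_ne_zero]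

theorem monotone_dyadicPoint (n : ℕ) : Monotone (dyadicPoint n) := fun _ _ h =>
  Set.monotone_projIcc _ (by gcongr)

theorem strictMonoOn_dyadicPoint (n : ℕ) : StrictMonoOn (dyadicPoint n) (Set.Iic (2 ^ n)) :=
  fun j hj k hk hjk => by
    rw [← Subtype.coe_lt_coe, coe_dyadicPoint hj, coe_dyadicPoint hk]
    gcongr

theorem coe_dyadicPoint_succ_sub {n k : ℕ} (hk : k < 2 ^ n) :
    (dyadicPoint n (k + 1) : ℝ) - dyadicPoint n k = (1 / 2) ^ n := by
  rw [coe_dyadicPoint hk, coe_dyadicPoint hk.le, one_div, inv_pow]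
  push_cast
  ring

theorem dist_dyadicPoint_succ {n k : ℕ} (hk : k < 2 ^ n) :
    dist (dyadicPoint n (k + 1)) (dyadicPoint n k) = (1 / 2) ^ n := by
  rw [Subtype.dist_eq, Real.dist_eq, coe_dyadicPoint_succ_sub hk, abs_of_pos (by positivity)]

theorem exists_dyadicPoint_tendsto {s t : I} (hst : s < t) :
    ∃ j k : ℕ → ℕ, (∀ᶠ n in atTop, j n < k n ∧ k n ≤ 2 ^ n ∧
        s ≤ dyadicPoint n (j n) ∧ dyadicPoint n (k n) ≤ t) ∧
      Tendsto (fun n => dyadicPoint n (j n)) atTop (𝓝 s) ∧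
      Tendsto (fun n => dyadicPoint n (k n)) atTop (𝓝 t) := by
  have hpow (n : ℕ) : (0 : ℝ) < 2 ^ n := by positivity
  let j n := ⌈(s : ℝ) * 2 ^ n⌉₊
  let k n := ⌊(t : ℝ) * 2 ^ n⌋₊
  have hj (n) : j n ≤ 2 ^ n :=
    Nat.ceil_le.2 (by push_cast; exact mul_le_of_le_one_left (hpow n).le s.2.2)
  have hk (n) : k n ≤ 2 ^ n :=
    Nat.floor_le_of_le (by push_cast; exact mul_le_of_le_one_left (hpow n).le t.2.2)
  have hzero : Tendsto (fun n : ℕ => ((2 : ℝ) ^ n)⁻¹) atTop (𝓝 0) :=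
    tendsto_inv_atTop_zero.comp (tendsto_pow_atTop_atTop_of_one_lt one_lt_two)
  have s_le (n) : s ≤ dyadicPoint n (j n) := by
    rw [← Subtype.coe_le_coe, coe_dyadicPoint (hj n), le_div_iff₀ (hpow n)]
    exact Nat.le_ceil _
  have le_t (n) : dyadicPoint n (k n) ≤ t := by
    rw [← Subtype.coe_le_coe, coe_dyadicPoint (hk n), div_le_iff₀ (hpow n)]
    exact Nat.floor_le (mul_nonneg t.2.1 (hpow n).le)
  have tendsto_s : Tendsto (fun n => dyadicPoint n (j n)) atTop (𝓝 s) := by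
    refine tendsto_subtype_rng.2 (tendsto_of_tendsto_of_tendsto_of_le_of_le tendsto_const_nhds
      (by simpa using hzero.const_add (s : ℝ)) (fun n => s_le n) fun n => ?_)
    rw [coe_dyadicPoint (hj n), div_le_iff₀ (hpow n), add_mul, inv_mul_cancel₀ (hpow n).ne']
    exact (Nat.ceil_lt_add_one (mul_nonneg s.2.1 (hpow n).le)).le
  have tendsto_t : Tendsto (fun n => dyadicPoint n (k n)) atTop (𝓝 t) := by
    refine tendsto_subtype_rng.2 (tendsto_of_tendsto_of_tendsto_of_le_of_le
      (by simpa using hzero.const_sub (t : ℝ)) tendsto_const_nhds (fun n => ?_) fun n => le_t n)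
    rw [coe_dyadicPoint (hk n), le_div_iff₀ (hpow n), sub_mul, inv_mul_cancel₀ (hpow n).ne']
    exact (Nat.sub_one_lt_floor _).le
  refine ⟨j, k, ?_, tendsto_s, tendsto_t⟩
  filter_upwards [tendsto_s.eventually_lt tendsto_t hst] with n hn
  exact ⟨(monotone_dyadicPoint n).reflect_lt hn, hk n, s_le n, le_t n⟩

/-- The left-point Riemann–Stieltjes sum `∑ g(tₖ) (f(tₖ₊₁) - f(tₖ))` over the dyadic partition
of level `n`. -/
def dyadicSum {E : Type*} [AddCommGroup E] [Module ℝ E] (g : I → ℝ) (f : I → E) (n : ℕ) : E :=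
  ∑ k ∈ Finset.range (2 ^ n),
    g (dyadicPoint n k) • (f (dyadicPoint n (k + 1)) - f (dyadicPoint n k))

theorem HasYoungIntegral.tendsto_dyadicSum {g x : I → ℝ} {J : ℝ} (h : HasYoungIntegral g x J) :
    Tendsto (dyadicSum g x) atTop (𝓝 J) := by
  rw [Metric.tendsto_atTop]
  intro ε hε
  obtain ⟨δ, hδ, hsum⟩ := h ε hε
  obtain ⟨n₀, hn₀⟩ := exists_pow_lt_of_lt_one hδ (by norm_num : (1 / 2 : ℝ) < 1)
  refine ⟨n₀, fun n hn => ?_⟩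
  have hmono : Monotone fun i : Fin (2 ^ n + 1) => dyadicPoint n i :=
    (monotone_dyadicPoint n).comp Fin.val_strictMono.monotone
  have := hsum (2 ^ n) (fun i => dyadicPoint n i) (fun i => dyadicPoint n i) hmono (by simp)
    (by simp) (fun i => ⟨le_rfl, hmono Fin.castSucc_lt_succ.le⟩) fun i => by
      simp only [Fin.val_succ, Fin.val_castSucc, coe_dyadicPoint_succ_sub i.2]
      exact (pow_le_pow_of_le_one (by norm_num) (by norm_num) hn).trans_lt hn₀
  rw [Real.dist_eq, dyadicSum, ← Fin.sum_univ_eq_sum_range fun k =>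
    g (dyadicPoint n k) • (x (dyadicPoint n (k + 1)) - x (dyadicPoint n k))]
  simpa only [smul_eq_mul, Fin.val_succ, Fin.val_castSucc] using this

theorem sum_range_two_mul {E : Type*} [AddCommMonoid E] (φ : ℕ → E) (m : ℕ) :
    ∑ k ∈ Finset.range (2 * m), φ k = ∑ k ∈ Finset.range m, (φ (2 * k) + φ (2 * k + 1)) := by
  induction m with
  | zero => simp
  | succ m ih =>
    rw [mul_add_one, Finset.sum_range_succ, Finset.sum_range_succ, ih, Finset.sum_range_succ,
      add_assoc]

theorem dyadicSum_succ_sub {E : Type*} [AddCommGroup E] [Module ℝ E] (g : I → ℝ) (f : I → E)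
    (n : ℕ) :
    dyadicSum g f (n + 1) - dyadicSum g f n = ∑ k ∈ Finset.range (2 ^ n),
      (g (dyadicPoint (n + 1) (2 * k + 1)) - g (dyadicPoint (n + 1) (2 * k))) •
        (f (dyadicPoint (n + 1) (2 * k + 1 + 1)) - f (dyadicPoint (n + 1) (2 * k + 1))) := by
  unfold dyadicSum
  rw [pow_succ, mul_comm _ 2, sum_range_two_mul, ← Finset.sum_sub_distrib]
  refine Finset.sum_congr rfl fun k _ => ?_
  rw [← dyadicPoint_two_mul n k, ← dyadicPoint_two_mul n (k + 1), mul_add_one]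
  module

theorem cauchySeq_dyadicSum {E : Type*} [NormedAddCommGroup E] [NormedSpace ℝ E]
    {g : I → ℝ} {f : I → E} {L C τ α : ℝ≥0} (hg : HolderWith L τ g) (hf : HolderWith C α f)
    (hτα : 1 < τ + α) : CauchySeq (dyadicSum g f) := by
  set r : ℝ := (1 / 2) ^ ((τ + α : ℝ≥0) : ℝ) with hr
  have hr1 : 2 * r < 1 := by
    have : r < (1 / 2) ^ (1 : ℝ) :=
      Real.rpow_lt_rpow_of_exponent_gt (by norm_num) (by norm_num) (by exact_mod_cast hτα)
    rw [Real.rpow_one] at this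
    linarith
  have hr_pow (n : ℕ) :
      r ^ n = ((1 / 2 : ℝ) ^ n) ^ (τ : ℝ) * ((1 / 2 : ℝ) ^ n) ^ (α : ℝ) := by
    rw [hr, ← Real.rpow_add (by positivity), ← Real.rpow_natCast, ← Real.rpow_natCast,
      ← Real.rpow_mul (by norm_num), ← Real.rpow_mul (by norm_num), mul_comm, NNReal.coe_add]
  refine cauchySeq_of_le_geometric (2 * r) (L * C * r) hr1 fun n => ?_
  have hterm : ∀ k ∈ Finset.range (2 ^ n),
      ‖(g (dyadicPoint (n + 1) (2 * k + 1)) - g (dyadicPoint (n + 1) (2 * k))) •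
        (f (dyadicPoint (n + 1) (2 * k + 1 + 1)) - f (dyadicPoint (n + 1) (2 * k + 1)))‖
      ≤ L * C * r ^ (n + 1) := by
    intro k hk
    have hk' : 2 * k + 1 < 2 ^ (n + 1) := by
      have := Finset.mem_range.1 hk
      omega
    have hgk := hg.dist_le_of_le (dist_dyadicPoint_succ ((Nat.lt_succ_self _).trans hk')).le
    have hfk := hf.dist_le_of_le (dist_dyadicPoint_succ hk').le
    rw [norm_smul, ← dist_eq_norm, ← dist_eq_norm, hr_pow, mul_mul_mul_comm]
    exact mul_le_mul hgk hfk dist_nonneg (by positivity)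
  rw [dist_comm, dist_eq_norm, dyadicSum_succ_sub]
  refine (norm_sum_le_of_le _ hterm).trans_eq ?_
  rw [Finset.sum_const, Finset.card_range, nsmul_eq_mul]
  push_cast
  ring

/-! ### Dyadic energy -/

section DyadicEnergy

variable {E : Type*} [SeminormedAddCommGroup E] {x : I → E} {n : ℕ} {γ : ℝ} {s t : I}

/-- The sum of the squared increments of `x` over the dyadic intervals of level `n` that are
contained in `[s, t]`. -/
def levelEnergy (x : I → E) (n : ℕ) (s t : I) : ℝ :=
  ∑ k ∈ Finset.range (2 ^ n) with s ≤ dyadicPoint n k ∧ dyadicPoint n (k + 1) ≤ t,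
    ‖x (dyadicPoint n (k + 1)) - x (dyadicPoint n k)‖ ^ 2

theorem levelEnergy_nonneg : 0 ≤ levelEnergy x n s t :=
  Finset.sum_nonneg fun _ _ => sq_nonneg _

theorem isControl_levelEnergy (x : I → E) (n : ℕ) : IsControl (levelEnergy x n) where
  nonneg _ _ _ := levelEnergy_nonneg
  add_le s u t hsu hut := by
    unfold levelEnergy
    rw [← Finset.sum_union]
    · refine Finset.sum_le_sum_of_subset_of_nonneg (fun k hk => ?_) fun _ _ _ => sq_nonneg _
      simp only [Finset.mem_union, Finset.mem_filter] at hk ⊢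
      rcases hk with ⟨hk, hs, hu⟩ | ⟨hk, hu, ht⟩
      · exact ⟨hk, hs, hu.trans hut⟩
      · exact ⟨hk, hsu.trans hu, ht⟩
    · refine Finset.disjoint_filter.2 fun k hk hleft hright => ?_
      have hk := Finset.mem_range.1 hk
      exact (strictMonoOn_dyadicPoint n hk.le hk k.lt_succ_self).not_ge
        (hleft.2.trans hright.1)

theorem norm_sq_le_levelEnergy {k : ℕ} (hk : k < 2 ^ n) (hs : s ≤ dyadicPoint n k)
    (ht : dyadicPoint n (k + 1) ≤ t) :
    ‖x (dyadicPoint n (k + 1)) - x (dyadicPoint n k)‖ ^ 2 ≤ levelEnergy x n s t :=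
  Finset.single_le_sum (f := fun k => ‖x (dyadicPoint n (k + 1)) - x (dyadicPoint n k)‖ ^ 2)
    (fun _ _ => sq_nonneg _) (by simp [hk, hs, ht])

theorem pow_le_sub_of_dyadicPoint_mem {k : ℕ} (hk : k < 2 ^ n) (hs : s ≤ dyadicPoint n k)
    (ht : dyadicPoint n (k + 1) ≤ t) : (1 / 2 : ℝ) ^ n ≤ t - s := by
  rw [← coe_dyadicPoint_succ_sub hk]
  exact sub_le_sub ht hs

theorem levelEnergy_eq_zero (h : (t : ℝ) - s < (1 / 2) ^ n) : levelEnergy x n s t = 0 := by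
  unfold levelEnergy
  rw [Finset.filter_false_of_mem, Finset.sum_empty]
  exact fun k hk hst =>
    h.not_ge (pow_le_sub_of_dyadicPoint_mem (Finset.mem_range.1 hk) hst.1 hst.2)

theorem levelEnergy_le_levelEnergy_zero_one (hst : s ≤ t) :
    levelEnergy x n s t ≤ levelEnergy x n 0 1 :=
  (isControl_levelEnergy x n).mono bot_le hst le_top

theorem levelEnergy_zero_one : levelEnergy x n 0 1 =
    ∑ k ∈ Finset.range (2 ^ n), ‖x (dyadicPoint n (k + 1)) - x (dyadicPoint n k)‖ ^ 2 := by
  unfold levelEnergy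
  rw [Finset.filter_true_of_mem]
  exact fun k _ => ⟨bot_le, le_top⟩

/-- The weighted sum over all levels of the level energies of `x` on `[s, t]`; with weight
exponent `γ` it controls the `2 / (γ + 1)`-variation of a continuous path. -/
def dyadicEnergy (γ : ℝ) (x : I → E) (s t : I) : ℝ :=
  ∑' n, ((2 : ℝ) ^ γ) ^ n * levelEnergy x n s t

/-- The dyadic energy of `x` on `[0, 1]` is a convergent series. -/
def FiniteDyadicEnergy (γ : ℝ) (x : I → E) : Prop :=
  Summable fun n => ((2 : ℝ) ^ γ) ^ n * levelEnergy x n 0 1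

theorem two_rpow_pow_mul_levelEnergy_nonneg : 0 ≤ ((2 : ℝ) ^ γ) ^ n * levelEnergy x n s t :=
  mul_nonneg (by positivity) levelEnergy_nonneg

namespace FiniteDyadicEnergy

theorem summable (hx : FiniteDyadicEnergy γ x) (hst : s ≤ t) :
    Summable fun n => ((2 : ℝ) ^ γ) ^ n * levelEnergy x n s t :=
  Summable.of_nonneg_of_le (fun _ => two_rpow_pow_mul_levelEnergy_nonneg)
    (fun _ => mul_le_mul_of_nonneg_left (levelEnergy_le_levelEnergy_zero_one hst)
      (by positivity)) hx

theorem isControl_dyadicEnergy (hx : FiniteDyadicEnergy γ x) : IsControl (dyadicEnergy γ x) where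
  nonneg _ _ _ := tsum_nonneg fun _ => two_rpow_pow_mul_levelEnergy_nonneg
  add_le s u t hsu hut := by
    unfold dyadicEnergy
    rw [← (hx.summable hsu).tsum_add (hx.summable hut)]
    refine Summable.tsum_le_tsum (fun n => ?_) ((hx.summable hsu).add (hx.summable hut))
      (hx.summable (hsu.trans hut))
    rw [← mul_add]
    exact mul_le_mul_of_nonneg_left ((isControl_levelEnergy x n).add_le hsu hut) (by positivity)

theorem exists_dyadicEnergy_lt (hx : FiniteDyadicEnergy γ x) {η : ℝ} (hη : 0 < η) :
    ∃ δ > 0, ∀ s t : I, s ≤ t → (t : ℝ) - s < δ → dyadicEnergy γ x s t < η := by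
  obtain ⟨N, hN⟩ : ∃ N, ∑' n, ((2 : ℝ) ^ γ) ^ (n + N) * levelEnergy x (n + N) 0 1 < η :=
    ((tendsto_sum_nat_add fun n => ((2 : ℝ) ^ γ) ^ n *
      levelEnergy x n 0 1).eventually_lt_const hη).exists
  refine ⟨(1 / 2) ^ N, by positivity, fun s t hst hδ => lt_of_le_of_lt ?_ hN⟩
  have low_levels : ∀ n ∈ Finset.range N, ((2 : ℝ) ^ γ) ^ n * levelEnergy x n s t = 0 :=
    fun n hn => by
      rw [levelEnergy_eq_zero (hδ.trans_le (pow_le_pow_of_le_one (by norm_num) (by norm_num)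
        (Finset.mem_range.1 hn).le)), mul_zero]
  rw [dyadicEnergy, ← (hx.summable hst).sum_add_tsum_nat_add N, Finset.sum_eq_zero low_levels,
    zero_add]
  have htail {u v : I} (huv : u ≤ v) :
      Summable fun n => ((2 : ℝ) ^ γ) ^ (n + N) * levelEnergy x (n + N) u v :=
    (hx.summable huv).comp_injective (add_left_injective N)
  refine (htail hst).tsum_le_tsum (fun n => ?_) (htail zero_le_one)
  exact mul_le_mul_of_nonneg_left (levelEnergy_le_levelEnergy_zero_one hst) (by positivity)

end FiniteDyadicEnergy

/-- Chaining: the odd endpoints of `[j, k]` are stripped off at each level. -/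
theorem norm_dyadicPoint_sub_le {b : ℕ → ℝ} (hb0 : ∀ i, 0 ≤ b i)
    (hb : ∀ i k, k < 2 ^ i → s ≤ dyadicPoint i k → dyadicPoint i (k + 1) ≤ t →
      ‖x (dyadicPoint i (k + 1)) - x (dyadicPoint i k)‖ ≤ b i)
    {j k : ℕ} (hjk : j ≤ k) (hk : k ≤ 2 ^ n) (hs : s ≤ dyadicPoint n j)
    (ht : dyadicPoint n k ≤ t) :
    ‖x (dyadicPoint n k) - x (dyadicPoint n j)‖ ≤ 2 * ∑ i ∈ Finset.range (n + 1), b i := by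
  rcases hjk.eq_or_lt with rfl | hlt
  · simpa using Finset.sum_nonneg fun i _ => hb0 i
  induction n generalizing j k with
  | zero =>
    obtain ⟨rfl, rfl⟩ : j = 0 ∧ k = 1 := by simp at hk; omega
    have := hb 0 0 one_pos hs ht
    simp only [zero_add, Finset.sum_range_one] at this ⊢
    linarith [hb0 0]
  | succ n ih =>
    have adjacent {i l : ℕ} (hji : j ≤ i) (hil : i ≤ l) (hlk : l ≤ k) (hli : l ≤ i + 1) :
        ‖x (dyadicPoint (n + 1) l) - x (dyadicPoint (n + 1) i)‖ ≤ b (n + 1) := by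
      rcases hil.eq_or_lt with rfl | hil
      · simpa using hb0 (n + 1)
      · obtain rfl : l = i + 1 := by omega
        exact hb _ _ (by omega) (hs.trans (monotone_dyadicPoint _ hji))
          ((monotone_dyadicPoint _ hlk).trans ht)
    have inner_le : ‖x (dyadicPoint (n + 1) (2 * (k / 2)))
        - x (dyadicPoint (n + 1) (2 * ((j + 1) / 2)))‖ ≤ 2 * ∑ i ∈ Finset.range (n + 1), b i := by
      rcases (show (j + 1) / 2 ≤ k / 2 by omega).eq_or_lt with heq | hlt'
      · simpa [heq] using Finset.sum_nonneg fun i _ => hb0 i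
      · rw [dyadicPoint_two_mul, dyadicPoint_two_mul]
        refine ih hlt'.le (by omega) ?_ ?_ hlt' <;> rw [← dyadicPoint_two_mul]
        · exact hs.trans (monotone_dyadicPoint _ (by omega))
        · exact (monotone_dyadicPoint _ (by omega)).trans ht
    have left_le := adjacent le_rfl (show j ≤ 2 * ((j + 1) / 2) by omega) (by omega) (by omega)
    have right_le := adjacent (show j ≤ 2 * (k / 2) by omega) (by omega) le_rfl (by omega)
    rw [Finset.sum_range_succ, mul_add,
      ← sub_add_sub_cancel _ (x (dyadicPoint (n + 1) (2 * ((j + 1) / 2)))),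
      ← sub_add_sub_cancel _ (x (dyadicPoint (n + 1) (2 * (k / 2))))]
    linarith [norm_add₃_le (a := x (dyadicPoint (n + 1) k) - x (dyadicPoint (n + 1) (2 * (k / 2))))
      (b := x (dyadicPoint (n + 1) (2 * (k / 2))) - x (dyadicPoint (n + 1) (2 * ((j + 1) / 2))))
      (c := x (dyadicPoint (n + 1) (2 * ((j + 1) / 2))) - x (dyadicPoint (n + 1) j))]

namespace FiniteDyadicEnergy

theorem norm_dyadicPoint_succ_sub_le (hx : FiniteDyadicEnergy γ x) (hst : s ≤ t) {k : ℕ}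
    (hk : k < 2 ^ n) (hs : s ≤ dyadicPoint n k) (ht : dyadicPoint n (k + 1) ≤ t) :
    ‖x (dyadicPoint n (k + 1)) - x (dyadicPoint n k)‖
      ≤ ((1 / 2) ^ (γ / 2)) ^ n * √(dyadicEnergy γ x s t) := by
  have hweight : (2 : ℝ) ^ γ * ((1 / 2) ^ (γ / 2)) ^ 2 = 1 := by
    rw [← Real.rpow_mul_natCast (by norm_num), Nat.cast_ofNat, div_mul_cancel₀ _ two_ne_zero,
      ← Real.mul_rpow two_pos.le (by norm_num), mul_one_div_cancel two_ne_zero, Real.one_rpow]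
  have hlevel : ((2 : ℝ) ^ γ) ^ n * levelEnergy x n s t ≤ dyadicEnergy γ x s t :=
    (hx.summable hst).le_tsum n fun _ _ => two_rpow_pow_mul_levelEnergy_nonneg
  refine le_of_sq_le_sq ?_ (by positivity)
  calc ‖x (dyadicPoint n (k + 1)) - x (dyadicPoint n k)‖ ^ 2
      ≤ levelEnergy x n s t := norm_sq_le_levelEnergy hk hs ht
    _ = (((1 / 2) ^ (γ / 2)) ^ n) ^ 2 * (((2 : ℝ) ^ γ) ^ n * levelEnergy x n s t) := by
        rw [← mul_assoc, ← pow_mul, mul_comm n 2, pow_mul, ← mul_pow, mul_comm _ ((2 : ℝ) ^ γ),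
          hweight, one_pow, one_mul]
    _ ≤ (((1 / 2) ^ (γ / 2)) ^ n) ^ 2 * dyadicEnergy γ x s t := by gcongr
    _ = (((1 / 2) ^ (γ / 2)) ^ n * √(dyadicEnergy γ x s t)) ^ 2 := by
        rw [mul_pow, Real.sq_sqrt (hx.isControl_dyadicEnergy.nonneg hst)]

theorem norm_dyadicPoint_sub_le (hx : FiniteDyadicEnergy γ x) (hγ : 0 < γ) (hst : s < t)
    {j k : ℕ} (hjk : j ≤ k) (hk : k ≤ 2 ^ n) (hs : s ≤ dyadicPoint n j)
    (ht : dyadicPoint n k ≤ t) :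
    ‖x (dyadicPoint n k) - x (dyadicPoint n j)‖ ≤
      2 * 2 ^ (γ / 2) / (1 - (1 / 2) ^ (γ / 2)) *
        (((t : ℝ) - s) ^ (γ / 2) * √(dyadicEnergy γ x s t)) := by
  set r : ℝ := (1 / 2) ^ (γ / 2) with hr
  have hr0 : 0 < r := by positivity
  have hr1 : r < 1 := Real.rpow_lt_one (by norm_num) (by norm_num) (by linarith)
  have hlen : 0 < (t : ℝ) - s := sub_pos.2 hst
  obtain ⟨m, hm_lt, hm_le⟩ := exists_nat_pow_near_of_lt_one hlen
    (by linarith [t.2.2, s.2.1]) (by norm_num : (0 : ℝ) < 1 / 2) (by norm_num)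
  have hrm : r ^ m ≤ 2 ^ (γ / 2) * ((t : ℝ) - s) ^ (γ / 2) := by
    rw [hr, Real.rpow_pow_comm (by norm_num), ← Real.mul_rpow two_pos.le hlen.le]
    refine Real.rpow_le_rpow (by positivity) ?_ (by linarith)
    rw [pow_succ] at hm_lt
    linarith
  have hchain := _root_.norm_dyadicPoint_sub_le (x := x)
    (b := fun i => if m ≤ i then r ^ i * √(dyadicEnergy γ x s t) else 0)
    (fun i => by positivity) (fun i l hl hsl hlt => by
      split_ifs with hmi
      · exact hx.norm_dyadicPoint_succ_sub_le hst.le hl hsl hlt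
      · have := pow_lt_pow_right_of_lt_one₀ (by norm_num : (0 : ℝ) < 1 / 2) (by norm_num)
          (not_le.1 hmi)
        linarith [pow_le_sub_of_dyadicPoint_mem hl hsl hlt]) hjk hk hs ht
  have hIco : (Finset.range (n + 1)).filter (m ≤ ·) = Finset.Ico m (n + 1) := by
    ext; simp [and_comm]
  rw [← Finset.sum_filter, hIco, ← Finset.sum_mul] at hchain
  calc ‖x (dyadicPoint n k) - x (dyadicPoint n j)‖
      ≤ 2 * ((∑ i ∈ Finset.Ico m (n + 1), r ^ i) * √(dyadicEnergy γ x s t)) := hchain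
    _ ≤ 2 * (2 ^ (γ / 2) * ((t : ℝ) - s) ^ (γ / 2) / (1 - r) * √(dyadicEnergy γ x s t)) := by
        gcongr
        exact (geom_sum_Ico_le_of_lt_one hr0.le hr1).trans
          (div_le_div_of_nonneg_right hrm (by linarith))
    _ = 2 * 2 ^ (γ / 2) / (1 - r) * (((t : ℝ) - s) ^ (γ / 2) * √(dyadicEnergy γ x s t)) := by
        ring

theorem norm_sub_le (hx : FiniteDyadicEnergy γ x) (hγ : 0 < γ) (hcont : Continuous x)
    (hst : s < t) :
    ‖x t - x s‖ ≤ 2 * 2 ^ (γ / 2) / (1 - (1 / 2) ^ (γ / 2)) *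
      (((t : ℝ) - s) ^ (γ / 2) * √(dyadicEnergy γ x s t)) := by
  obtain ⟨j, k, hjk, hj, hk⟩ := exists_dyadicPoint_tendsto hst
  refine le_of_tendsto (((hcont.tendsto t).comp hk).sub ((hcont.tendsto s).comp hj)).norm ?_
  filter_upwards [hjk] with n ⟨hlt, hle, hs, ht⟩
  exact hx.norm_dyadicPoint_sub_le hγ hst hlt.le hle hs ht

theorem exists_hasYoungIntegral {γ : ℝ} {x g : I → ℝ} (hx : FiniteDyadicEnergy γ x)
    (hγ : 0 < γ) (hcont : Continuous x) {L τ : ℝ≥0} (hg : HolderWith L τ g)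
    (hτγ : 1 < τ + (γ + 1) / 2) : ∃ J, HasYoungIntegral g x J := by
  have hlen : IsControl fun s t : I => (t : ℝ) - s :=
    ⟨fun s t hst => sub_nonneg.2 hst, fun s u t _ _ => by linarith⟩
  have henergy := hx.isControl_dyadicEnergy
  have hr : (1 / 2 : ℝ) ^ (γ / 2) < 1 :=
    Real.rpow_lt_one (by norm_num) (by norm_num) (by linarith)
  refine (hlen.add henergy).exists_hasYoungIntegral (fun η hη => ?_) L.2
    (C := 2 * 2 ^ (γ / 2) / (1 - (1 / 2) ^ (γ / 2)))
    (div_nonneg (by positivity) (by linarith)) τ.2 (by linarith) hτγ (fun s t hst => ?_)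
    fun s t hst => ?_
  · obtain ⟨δ, hδ, hsmall⟩ := hx.exists_dyadicEnergy_lt (half_pos hη)
    refine ⟨min δ (η / 2), by positivity, fun s t hst h => ?_⟩
    linarith [hsmall s t hst (h.trans_le (min_le_left _ _)), min_le_right δ (η / 2)]
  · have := hg.dist_le t s
    rw [Real.dist_eq, Subtype.dist_eq, Real.dist_eq, abs_of_nonneg (hlen.nonneg hst)] at this
    exact this.trans (mul_le_mul_of_nonneg_left (Real.rpow_le_rpow (hlen.nonneg hst)
      (by linarith [henergy.nonneg hst]) τ.2) L.2)
  · rcases hst.eq_or_lt with rfl | hlt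
    · simp [henergy.self_eq_zero, Real.zero_rpow (show (γ + 1) / 2 ≠ 0 by linarith)]
    refine (hx.norm_sub_le hγ hcont hlt).trans (mul_le_mul_of_nonneg_left ?_
      (div_nonneg (by positivity) (by linarith)))
    have h₁ := hlen.nonneg hst
    have h₂ := henergy.nonneg hst
    rw [add_div, Real.rpow_add_of_nonneg (add_nonneg h₁ h₂) (by linarith) (by norm_num),
      ← Real.sqrt_eq_rpow]
    gcongr <;> linarith

end FiniteDyadicEnergy

end DyadicEnergy

/-! ### Processes with Hölder second moments -/

section SecondMoments

variable {Ω : Type*} [MeasurableSpace Ω] {P : Measure Ω}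

theorem ae_summable_norm_of_summable_integral_norm {E : Type*} [NormedAddCommGroup E]
    {u : ℕ → Ω → E} (hu : ∀ n, Integrable (u n) P) (hsum : Summable fun n => ∫ ω, ‖u n ω‖ ∂P) :
    ∀ᵐ ω ∂P, Summable fun n => ‖u n ω‖ := by
  refine summable_norm_of_tsum_eLpNorm_ne_top (p := 1) le_rfl
    (fun n => (hu n).aestronglyMeasurable) ?_
  simp only [eLpNorm_one_eq_lintegral_enorm, ← ofReal_integral_norm_eq_lintegral_enorm (hu _)]
  exact hsum.tsum_ofReal_ne_top

section DyadicEnergy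

variable {E : Type*} [SeminormedAddCommGroup E] {X : I → Ω → E} {K θ γ : ℝ}

theorem integrable_levelEnergy (hX : ∀ s t, Integrable (fun ω => ‖X t ω - X s ω‖ ^ 2) P)
    (n : ℕ) (s t : I) : Integrable (fun ω => levelEnergy (fun u => X u ω) n s t) P :=
  integrable_finsetSum _ fun _ _ => hX _ _

theorem integral_levelEnergy_le (hX : ∀ s t, Integrable (fun ω => ‖X t ω - X s ω‖ ^ 2) P)
    (hmoment : ∀ s t : I, s < t → ∫ ω, ‖X t ω - X s ω‖ ^ 2 ∂P ≤ K * ((t : ℝ) - s) ^ θ) (n : ℕ) :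
    ∫ ω, levelEnergy (fun u => X u ω) n 0 1 ∂P ≤ K * (2 ^ (1 - θ)) ^ n := by
  have hterm : ∀ k ∈ Finset.range (2 ^ n),
      ∫ ω, ‖X (dyadicPoint n (k + 1)) ω - X (dyadicPoint n k) ω‖ ^ 2 ∂P
        ≤ K * ((1 / 2 : ℝ) ^ n) ^ θ := fun k hk => by
    have hk := Finset.mem_range.1 hk
    rw [← coe_dyadicPoint_succ_sub hk]
    exact hmoment _ _ (strictMonoOn_dyadicPoint n hk.le hk k.lt_succ_self)
  have hpow : (2 : ℝ) ^ n * ((1 / 2 : ℝ) ^ n) ^ θ = (2 ^ (1 - θ)) ^ n := by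
    rw [← Real.rpow_pow_comm (by norm_num), ← mul_pow, Real.rpow_sub two_pos, Real.rpow_one,
      one_div, Real.inv_rpow two_pos.le, div_eq_mul_inv]
  simp only [levelEnergy_zero_one]
  rw [integral_finsetSum _ fun k _ => hX _ _]
  refine (Finset.sum_le_sum hterm).trans_eq ?_
  rw [Finset.sum_const, Finset.card_range, nsmul_eq_mul, ← hpow]
  push_cast
  ring

theorem ae_finiteDyadicEnergy (hX : ∀ s t, Integrable (fun ω => ‖X t ω - X s ω‖ ^ 2) P)
    (hmoment : ∀ s t : I, s < t → ∫ ω, ‖X t ω - X s ω‖ ^ 2 ∂P ≤ K * ((t : ℝ) - s) ^ θ)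
    (hγ : γ + 1 < θ) : ∀ᵐ ω ∂P, FiniteDyadicEnergy γ fun t => X t ω := by
  have hnorm (n : ℕ) (ω : Ω) : ‖((2 : ℝ) ^ γ) ^ n * levelEnergy (fun u => X u ω) n 0 1‖
      = ((2 : ℝ) ^ γ) ^ n * levelEnergy (fun u => X u ω) n 0 1 :=
    Real.norm_of_nonneg two_rpow_pow_mul_levelEnergy_nonneg
  have hratio : (2 : ℝ) ^ γ * 2 ^ (1 - θ) < 1 := by
    rw [← Real.rpow_add two_pos]
    exact Real.rpow_lt_one_of_one_lt_of_neg one_lt_two (by linarith)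
  have hae := ae_summable_norm_of_summable_integral_norm
    (fun n => (integrable_levelEnergy hX n 0 1).const_mul (((2 : ℝ) ^ γ) ^ n)) <| by
      simp only [hnorm, integral_const_mul]
      refine Summable.of_nonneg_of_le (fun n => mul_nonneg (by positivity)
        (integral_nonneg fun ω => levelEnergy_nonneg)) (fun n => ?_)
        ((summable_geometric_of_lt_one (by positivity) hratio).mul_left K)
      calc ((2 : ℝ) ^ γ) ^ n * ∫ ω, levelEnergy (fun u => X u ω) n 0 1 ∂P
          ≤ ((2 : ℝ) ^ γ) ^ n * (K * (2 ^ (1 - θ)) ^ n) := by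
            gcongr
            exact integral_levelEnergy_le hX hmoment n
        _ = K * (2 ^ γ * 2 ^ (1 - θ)) ^ n := by rw [mul_pow]; ring
  filter_upwards [hae] with ω hω
  simpa only [FiniteDyadicEnergy, hnorm] using hω

end DyadicEnergy

theorem hasYoungIntegral_youngIntegral {g x : I → ℝ} (h : ∃ J, HasYoungIntegral g x J) :
    HasYoungIntegral g x (youngIntegral g x) := by
  rw [youngIntegral, dif_pos h]
  exact h.choose_spec

theorem ae_hasYoungIntegral_youngIntegral {X : I → Ω → ℝ} {K θ : ℝ}
    (hX : ∀ s t, Integrable (fun ω => ‖X t ω - X s ω‖ ^ 2) P)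
    (hmoment : ∀ s t : I, s < t → ∫ ω, ‖X t ω - X s ω‖ ^ 2 ∂P ≤ K * ((t : ℝ) - s) ^ θ)
    (hcont : ∀ᵐ ω ∂P, Continuous fun t => X t ω) (hθ : 1 < θ) {g : I → ℝ} {L τ : ℝ≥0}
    (hg : HolderWith L τ g) (hτθ : 1 < τ + θ / 2) :
    ∀ᵐ ω ∂P, HasYoungIntegral g (fun t => X t ω) (youngIntegral g fun t => X t ω) := by
  obtain ⟨γ, hγ, hγθ⟩ : ∃ γ : ℝ, max 0 (1 - 2 * (τ : ℝ)) < γ ∧ γ < θ - 1 :=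
    exists_between (max_lt (by linarith) (by linarith))
  rw [max_lt_iff] at hγ
  filter_upwards [ae_finiteDyadicEnergy hX hmoment (by linarith : γ + 1 < θ), hcont]
    with ω henergy hω
  exact hasYoungIntegral_youngIntegral
    (henergy.exists_hasYoungIntegral hγ.1 hω hg (by linarith [hγ.2]))

end SecondMoments

/-! ### Hermite polynomials of Gaussian variables -/

section Hermite

open Polynomial

theorem hasDerivAt_gaussianPDFReal (m : ℝ) (v : ℝ≥0) (x : ℝ) :
    HasDerivAt (gaussianPDFReal m v) (-((x - m) / v) * gaussianPDFReal m v x) x := by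
  have hexponent : HasDerivAt (fun y : ℝ => -(y - m) ^ 2 / (2 * v)) (-((x - m) / v)) x := by
    refine ((((hasDerivAt_id x).sub_const m).fun_pow 2).fun_neg.div_const _).congr_deriv ?_
    simp only [id_eq, Nat.cast_ofNat, Nat.add_one_sub_one, pow_one, mul_one]
    ring
  refine (hexponent.exp.const_mul (√(2 * Real.pi * v))⁻¹).congr_deriv ?_
  rw [gaussianPDFReal]
  ring

theorem integrable_gaussianReal_iff {m : ℝ} {v : ℝ≥0} (hv : v ≠ 0) {φ : ℝ → ℝ} :
    Integrable φ (gaussianReal m v) ↔ Integrable fun x => gaussianPDFReal m v x * φ x := by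
  rw [gaussianReal_of_var_ne_zero m hv, integrable_withDensity_iff_integrable_smul'
    (measurable_gaussianPDF m v) (Eventually.of_forall fun _ => gaussianPDF_lt_top)]
  simp only [toReal_gaussianPDF, smul_eq_mul]

/-- Gaussian integration by parts (Stein's lemma). -/
theorem integral_sub_mul_gaussianReal {m : ℝ} {v : ℝ≥0} {φ φ' : ℝ → ℝ}
    (hφ : ∀ x, HasDerivAt φ (φ' x) x) (hi : Integrable φ (gaussianReal m v))
    (hi' : Integrable φ' (gaussianReal m v))
    (hix : Integrable (fun x => (x - m) * φ x) (gaussianReal m v)) :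
    ∫ x, (x - m) * φ x ∂gaussianReal m v = v * ∫ x, φ' x ∂gaussianReal m v := by
  rcases eq_or_ne v 0 with rfl | hv
  · simp
  rw [integrable_gaussianReal_iff hv] at hi hi' hix
  have hderiv : ∀ x, HasDerivAt (fun x => gaussianPDFReal m v x * φ x)
      (gaussianPDFReal m v x * φ' x - (v : ℝ)⁻¹ * (gaussianPDFReal m v x * ((x - m) * φ x))) x :=
    fun x => ((hasDerivAt_gaussianPDFReal m v x).mul (hφ x)).congr_deriv (by ring)
  have hzero := integral_eq_zero_of_hasDerivAt_of_integrable hderiv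
    (hi'.sub (hix.const_mul _)) hi
  rw [integral_sub hi' (hix.const_mul _), integral_const_mul, sub_eq_zero] at hzero
  simp only [integral_gaussianReal_eq_integral_smul hv, smul_eq_mul]
  rw [hzero, mul_inv_cancel_left₀ (NNReal.coe_ne_zero.2 hv)]

theorem integrable_eval_gaussianReal (m : ℝ) (v : ℝ≥0) (p : ℝ[X]) :
    Integrable (fun x => p.eval x) (gaussianReal m v) := by
  have hpow : ∀ k : ℕ, Integrable (fun x : ℝ => x ^ k) (gaussianReal m v) := by
    intro k
    rcases eq_or_ne k 0 with rfl | hk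
    · simp
    · refine ((memLp_id_gaussianReal (k : ℝ≥0)).integrable_norm_pow (p := k) hk).mono'
        (by fun_prop) (Eventually.of_forall fun x => ?_)
      simp
  simp only [eval_eq_sum_range]
  exact integrable_finsetSum _ fun k _ => (hpow k).const_mul _

/-- The expectation of a polynomial under the Gaussian law with mean `m` and variance `v`. -/
def gaussianExpectation (m : ℝ) (v : ℝ≥0) : ℝ[X] →ₗ[ℝ] ℝ where
  toFun p := ∫ x, p.eval x ∂gaussianReal m v
  map_add' p q := by
    simpa only [eval_add] using
      integral_add (integrable_eval_gaussianReal m v p) (integrable_eval_gaussianReal m v q)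
  map_smul' a p := by
    simp only [eval_smul, smul_eq_mul, integral_const_mul, RingHom.id_apply]

theorem gaussianExpectation_apply (m : ℝ) (v : ℝ≥0) (p : ℝ[X]) :
    gaussianExpectation m v p = ∫ x, p.eval x ∂gaussianReal m v := rfl

theorem gaussianExpectation_X_mul (m : ℝ) (v : ℝ≥0) (p : ℝ[X]) :
    gaussianExpectation m v (X * p) =
      m * gaussianExpectation m v p + v * gaussianExpectation m v (derivative p) := by
  have hint := integrable_eval_gaussianReal m v
  have hstein : gaussianExpectation m v ((X - C m) * p) =
      v * gaussianExpectation m v (derivative p) := by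
    have hix : Integrable (fun x => (x - m) * p.eval x) (gaussianReal m v) := by
      refine (hint ((X - C m) * p)).congr (Eventually.of_forall fun x => ?_)
      simp only [eval_mul, eval_sub, eval_X, eval_C]
    simpa [gaussianExpectation_apply] using
      integral_sub_mul_gaussianReal (fun x => p.hasDerivAt x) (hint p) (hint _) hix
  rw [← hstein, sub_mul, map_sub, ← smul_eq_C_mul, map_smul, smul_eq_mul]
  ring

/-- The probabilists' Hermite polynomial with real coefficients. -/
def hermiteReal (n : ℕ) : ℝ[X] := (hermite n).map (Int.castRingHom ℝ)

theorem aeval_hermite_eq_eval_hermiteReal (n : ℕ) (x : ℝ) :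
    aeval x (hermite n) = (hermiteReal n).eval x := by
  rw [aeval_def, eval₂_eq_eval_map, hermiteReal, algebraMap_int_eq]

@[simp]
theorem hermiteReal_zero : hermiteReal 0 = 1 := by simp [hermiteReal]

theorem hermiteReal_succ (n : ℕ) :
    hermiteReal (n + 1) = X * hermiteReal n - derivative (hermiteReal n) := by
  simp [hermiteReal, hermite_succ]

theorem derivative_hermiteReal_succ (n : ℕ) :
    derivative (hermiteReal (n + 1)) = ((n : ℝ) + 1) • hermiteReal n := by
  induction n with
  | zero => simp [hermiteReal_succ]
  | succ n ih =>
    rw [hermiteReal_succ (n + 1), derivative_sub, derivative_mul, ih, derivative_smul,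
      derivative_X, one_mul, mul_smul_comm, hermiteReal_succ n]
    push_cast
    module

theorem gaussianExpectation_hermiteReal_sq (n : ℕ) :
    gaussianExpectation 0 1 (hermiteReal n * hermiteReal n) = n.factorial := by
  induction n with
  | zero => simp [gaussianExpectation_apply]
  | succ n ih =>
    have hexpand : hermiteReal (n + 1) * hermiteReal (n + 1) =
        X * (hermiteReal n * hermiteReal (n + 1)) -
          derivative (hermiteReal n) * hermiteReal (n + 1) := by
      nth_rewrite 1 [hermiteReal_succ]
      ring
    rw [hexpand, map_sub, gaussianExpectation_X_mul, derivative_mul, derivative_hermiteReal_succ,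
      map_add, mul_smul_comm, map_smul, ih, Nat.factorial_succ]
    push_cast
    rw [smul_eq_mul]
    ring

/-- Mehler's formula: the Ornstein–Uhlenbeck kernel, which sends `x` to the Gaussian law with
mean `c x` and variance `1 - c ^ 2`, has the Hermite polynomials as eigenvectors. -/
theorem gaussianExpectation_hermiteReal {c : ℝ} {v : ℝ≥0} (hv : (v : ℝ) = 1 - c ^ 2) (x : ℝ)
    (n : ℕ) :
    gaussianExpectation (c * x) v (hermiteReal n) = c ^ n * (hermiteReal n).eval x := by
  induction n using Nat.twoStepInduction with
  | zero => simp [gaussianExpectation_apply]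
  | one =>
    simp [hermiteReal_succ, gaussianExpectation_apply]
  | more n ih₀ ih₁ =>
    rw [hermiteReal_succ (n + 1), map_sub, gaussianExpectation_X_mul, ih₁,
      derivative_hermiteReal_succ, map_smul, ih₀, hv]
    simp only [smul_eq_mul, eval_sub, eval_mul, eval_X, eval_smul]
    ring

end Hermite

/-! ### Covariance of multiple Wiener–Itô integrals -/

section Wiener

theorem map_add_smul_of_inner_map_map {E F : Type*} [NormedAddCommGroup E] [InnerProductSpace ℝ E]
    [NormedAddCommGroup F] [InnerProductSpace ℝ F] {U : E → F}
    (hU : ∀ x y, inner ℝ (U x) (U y) = inner ℝ x y) (c : ℝ) (x y : E) :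
    U (x + c • y) = U x + c • U y := by
  have horth : ∀ w, inner ℝ (U (x + c • y) - (U x + c • U y)) (U w) = 0 := fun w => by
    simp only [inner_sub_left, inner_add_left, real_inner_smul_left, hU, sub_self]
  rw [← sub_eq_zero, ← inner_self_eq_zero (𝕜 := ℝ)]
  nth_rewrite 2 [← one_smul ℝ (U (x + c • y))]
  simp only [inner_sub_right, inner_add_right, real_inner_smul_right, horth]
  ring

theorem inner_snd_eq_mul_inner_fst_of_mem_closure_span {E F : Type*} [NormedAddCommGroup E]
    [InnerProductSpace ℝ E] [NormedAddCommGroup F] [InnerProductSpace ℝ F] {S : Set (E × F)}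
    {κ : ℝ} (hS : ∀ p ∈ S, ∀ q ∈ S, inner ℝ p.2 q.2 = κ * inner ℝ p.1 q.1) {p q : E × F}
    (hp : p ∈ (Submodule.span ℝ S).topologicalClosure)
    (hq : q ∈ (Submodule.span ℝ S).topologicalClosure) :
    inner ℝ p.2 q.2 = κ * inner ℝ p.1 q.1 := by
  have hextend : ∀ p : E × F, (∀ q ∈ S, inner ℝ p.2 q.2 = κ * inner ℝ p.1 q.1) →
      ∀ q ∈ (Submodule.span ℝ S).topologicalClosure, inner ℝ p.2 q.2 = κ * inner ℝ p.1 q.1 := by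
    intro p hp q hq
    let L : E × F →L[ℝ] ℝ := (innerSL ℝ p.2).comp (ContinuousLinearMap.snd ℝ E F) -
      κ • (innerSL ℝ p.1).comp (ContinuousLinearMap.fst ℝ E F)
    have hL : ∀ q, L q = inner ℝ p.2 q.2 - κ * inner ℝ p.1 q.1 := fun q => by simp [L]
    have hker : (Submodule.span ℝ S).topologicalClosure ≤ LinearMap.ker L.toLinearMap :=
      Submodule.topologicalClosure_minimal _
        (Submodule.span_le.2 fun q hq => by simp [hL, hp q hq]) L.isClosed_ker
    have hLq : L q = 0 := hker hq
    linarith [hL q]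
  refine hextend p (fun s hs => ?_) q hq
  simpa only [real_inner_comm] using hextend s (hS s hs) p hp

variable {H : Type*} [NormedAddCommGroup H] [InnerProductSpace ℝ H]
  {Ω : Type*} [MeasurableSpace Ω] {W : H → Ω → ℝ} {P : Measure Ω}

theorem inner_toLp_toLp {Y Y' : Ω → ℝ} (hY : MemLp Y 2 P) (hY' : MemLp Y' 2 P) :
    inner ℝ (hY.toLp Y) (hY'.toLp Y') = ∫ ω, Y ω * Y' ω ∂P := by
  rw [L2.inner_def]
  refine integral_congr_ae ?_
  filter_upwards [hY.coeFn_toLp, hY'.coeFn_toLp] with ω hω hω'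
  rw [hω, hω', Real.inner_apply]

namespace IsIsonormalGaussian

theorem hasGaussianLaw (hW : IsIsonormalGaussian W P) (h : H) : HasGaussianLaw (W h) P :=
  hW.isGaussianProcess.hasGaussianLaw_eval h

theorem map_eq_gaussianReal (hW : IsIsonormalGaussian W P) (h : H) :
    P.map (W h) = gaussianReal 0 (‖h‖₊ ^ 2) := by
  have hvar : Var[W h; P] = ‖h‖₊ ^ 2 := by
    rw [variance_eq_integral (hW.hasGaussianLaw h).aemeasurable, hW.centered]
    simp only [sub_zero, sq, hW.covariance, real_inner_self_eq_norm_mul_norm, coe_nnnorm]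
  rw [(hW.hasGaussianLaw h).map_eq_gaussianReal, hW.centered, hvar, ← NNReal.coe_pow,
    Real.toNNReal_coe]

theorem apply_add_smul_ae_eq (hW : IsIsonormalGaussian W P) (c : ℝ) (h k : H) :
    W (h + c • k) =ᵐ[P] fun ω => W h ω + c * W k ω := by
  have hm : ∀ u, MemLp (W u) 2 P := fun u => (hW.hasGaussianLaw u).memLp_two
  have hinner : ∀ u w, inner ℝ ((hm u).toLp (W u)) ((hm w).toLp (W w)) = inner ℝ u w :=
    fun u w => by rw [inner_toLp_toLp, hW.covariance]
  have hlin := map_add_smul_of_inner_map_map hinner c h k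
  rw [← MemLp.toLp_const_smul, ← MemLp.toLp_add, MemLp.toLp_eq_toLp_iff] at hlin
  exact hlin

theorem indepFun_of_inner_eq_zero (hW : IsIsonormalGaussian W P) {h k : H}
    (hhk : inner ℝ h k = 0) : IndepFun (W h) (W k) P := by
  have := (hW.hasGaussianLaw h).isProbabilityMeasure
  refine HasGaussianLaw.indepFun_of_covariance_eq_zero
    hW.isGaussianProcess.hasGaussianLaw_prodMk ?_
  rw [covariance_eq_sub (hW.hasGaussianLaw h).memLp_two (hW.hasGaussianLaw k).memLp_two,
    hW.centered, zero_mul, sub_zero]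
  exact (hW.covariance h k).trans hhk

theorem memLp_two_eval (hW : IsIsonormalGaussian W P) (p : Polynomial ℝ) (h : H) :
    MemLp (fun ω => p.eval (W h ω)) 2 P := by
  have hWm : AEMeasurable (W h) P := (hW.hasGaussianLaw h).aemeasurable
  have hint := integrable_eval_gaussianReal 0 (‖h‖₊ ^ 2) (p * p)
  rw [← hW.map_eq_gaussianReal h, integrable_map_measure (by fun_prop) hWm] at hint
  refine (memLp_two_iff_integrable_sq
    (p.continuous.measurable.comp_aemeasurable hWm).aestronglyMeasurable).2 (hint.congr ?_)
  exact Eventually.of_forall fun ω => by simp [sq]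

theorem integral_mul_eval_add_of_inner_eq_zero (hW : IsIsonormalGaussian W P) {h z : H}
    (hhz : inner ℝ h z = 0) (c : ℝ) (p q : Polynomial ℝ) :
    ∫ ω, p.eval (W h ω) * q.eval (W (z + c • h) ω) ∂P =
      ∫ x, p.eval x * gaussianExpectation (c * x) (‖z‖₊ ^ 2) q ∂gaussianReal 0 (‖h‖₊ ^ 2) := by
  have := (hW.hasGaussianLaw h).isProbabilityMeasure
  have hmh := (hW.hasGaussianLaw h).aemeasurable
  have hmz := (hW.hasGaussianLaw z).aemeasurable
  have hlaw : P.map (fun ω => (W h ω, W z ω)) =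
      (gaussianReal 0 (‖h‖₊ ^ 2)).prod (gaussianReal 0 (‖z‖₊ ^ 2)) := by
    rw [(indepFun_iff_map_prod_eq_prod_map_map hmh hmz).1 (hW.indepFun_of_inner_eq_zero hhz),
      hW.map_eq_gaussianReal, hW.map_eq_gaussianReal]
  have hΦ : Continuous fun y : ℝ × ℝ => p.eval y.1 * q.eval (y.2 + c * y.1) := by fun_prop
  have hae : (fun ω => p.eval (W h ω) * q.eval (W (z + c • h) ω)) =ᵐ[P]
      fun ω => p.eval (W h ω) * q.eval (W z ω + c * W h ω) := by
    filter_upwards [hW.apply_add_smul_ae_eq c z h] with ω hω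
    rw [hω]
  have hint := ((hW.memLp_two_eval p h).integrable_mul
    (hW.memLp_two_eval q (z + c • h))).congr hae
  replace hint := (integrable_map_measure (f := fun ω => (W h ω, W z ω)) hΦ.aestronglyMeasurable
    (hmh.prodMk hmz)).2 hint
  rw [hlaw] at hint
  rw [integral_congr_ae hae, ← integral_map (φ := fun ω => (W h ω, W z ω)) (hmh.prodMk hmz)
    hΦ.aestronglyMeasurable, hlaw, integral_prod _ hint]
  refine integral_congr_ae (Eventually.of_forall fun x => ?_)
  have hshift : gaussianReal (c * x) (‖z‖₊ ^ 2) =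
      (gaussianReal 0 (‖z‖₊ ^ 2)).map (· + c * x) := by
    rw [gaussianReal_map_add_const, zero_add]
  simp only [integral_const_mul, gaussianExpectation_apply]
  rw [hshift, integral_map (by fun_prop) q.continuous.aestronglyMeasurable]

theorem integral_hermiteReal_mul_hermiteReal (hW : IsIsonormalGaussian W P) (n : ℕ) {h k : H}
    (hh : ‖h‖ = 1) (hk : ‖k‖ = 1) :
    ∫ ω, (hermiteReal n).eval (W h ω) * (hermiteReal n).eval (W k ω) ∂P =
      n.factorial * inner ℝ h k ^ n := by
  set c : ℝ := inner ℝ h k with hc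
  obtain ⟨z, hkz⟩ : ∃ z, z + c • h = k := ⟨k - c • h, sub_add_cancel _ _⟩
  have hhz : inner ℝ h z = 0 := by
    rw [eq_sub_of_add_eq hkz, inner_sub_right, real_inner_smul_right, real_inner_self_eq_norm_sq,
      hh, ← hc]
    ring
  have hnorm : ((‖z‖₊ ^ 2 : ℝ≥0) : ℝ) = 1 - c ^ 2 := by
    have h := norm_add_sq_real z (c • h)
    rw [hkz, hk, norm_smul, hh, real_inner_smul_right, real_inner_comm, hhz, mul_one,
      Real.norm_eq_abs, sq_abs] at h
    push_cast
    linarith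
  have hunit : ‖h‖₊ = 1 := NNReal.eq hh
  rw [← hkz, hW.integral_mul_eval_add_of_inner_eq_zero hhz, hunit, one_pow,
    ← gaussianExpectation_hermiteReal_sq, gaussianExpectation_apply, ← integral_mul_const]
  refine integral_congr_ae (Eventually.of_forall fun x => ?_)
  simp only [gaussianExpectation_hermiteReal hnorm, Polynomial.eval_mul]
  ring

theorem inner_snd_eq_of_mem_multipleIntegralGraph (hW : IsIsonormalGaussian W P) {n : ℕ}
    {p q : HilbertTensorPower H n × Lp ℝ 2 P} (hp : p ∈ multipleIntegralGraph W P n)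
    (hq : q ∈ multipleIntegralGraph W P n) :
    inner ℝ p.2 q.2 = n.factorial * inner ℝ p.1 q.1 := by
  refine inner_snd_eq_mul_inner_fst_of_mem_closure_span ?_ hp hq
  rintro p ⟨h, hh, hp₁, hp₂⟩ q ⟨k, hk, hq₁, hq₂⟩
  rw [hp₁, hq₁, inner_hilbertTprod, Finset.prod_const, Finset.card_univ, Fintype.card_fin,
    ← hW.integral_hermiteReal_mul_hermiteReal n hh hk, L2.inner_def]
  refine integral_congr_ae ?_
  filter_upwards [hp₂, hq₂] with ω hpω hqω
  rw [hpω, hqω, aeval_hermite_eq_eval_hermiteReal, aeval_hermite_eq_eval_hermiteReal,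
    Real.inner_apply]

end IsIsonormalGaussian

theorem IsMultipleIntegral.integral_mul (hW : IsIsonormalGaussian W P) {n : ℕ}
    {f f' : HilbertTensorPower H n} {Y Y' : Ω → ℝ} (hY : IsMultipleIntegral W P n f Y)
    (hY' : IsMultipleIntegral W P n f' Y') :
    ∫ ω, Y ω * Y' ω ∂P = n.factorial * inner ℝ f f' := by
  obtain ⟨hm, hgraph⟩ := hY
  obtain ⟨hm', hgraph'⟩ := hY'
  rw [← inner_toLp_toLp hm hm', hW.inner_snd_eq_of_mem_multipleIntegralGraph hgraph hgraph']

end Wiener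

/-! ### Lower bounds from the kernel assumptions -/

section Kernel

variable {E : Type*} [NormedAddCommGroup E] {f : I → E}

theorem KernelRegularity.exists_holderWith {θ : ℝ} (hreg : KernelRegularity f θ) :
    ∃ C α : ℝ≥0, (α : ℝ) = θ / 2 ∧ HolderWith C α f := by
  obtain ⟨hθ, -, C, hC, hinc⟩ := hreg
  have hle : ∀ s t : I, s ≤ t → dist (f s) (f t) ≤ C * dist s t ^ (θ / 2) := by
    intro s t hst
    rcases hst.eq_or_lt with rfl | hlt
    · rw [dist_self]
      positivity
    · rw [dist_comm, dist_eq_norm, dist_comm s, Subtype.dist_eq, Real.dist_eq,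
        abs_of_pos (sub_pos.2 (Subtype.coe_lt_coe.2 hlt))]
      exact (hinc s t hlt).2
  refine ⟨C.toNNReal, (θ / 2).toNNReal, Real.coe_toNNReal _ (by linarith), fun s t => ?_⟩
  wlog hst : s ≤ t generalizing s t
  · rw [edist_comm, edist_comm s]
    exact this t s (le_of_not_ge hst)
  rw [edist_dist, edist_dist, Real.coe_toNNReal _ (by linarith),
    ENNReal.ofReal_rpow_of_nonneg dist_nonneg (by linarith),
    ← ENNReal.ofReal, ← ENNReal.ofReal_mul hC.le]
  exact ENNReal.ofReal_le_ofReal (hle s t hst)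

theorem sub_mem_incrementsAlong {k : ℕ} {p : Fin (k + 1) → I} {q : ℕ → I} (hpq : ∀ e, p e = q e)
    {j : ℕ} (hj : j < k) : f (q (j + 1)) - f (q j) ∈ incrementsAlong f p :=
  ⟨⟨j, hj⟩, by simp only [hpq, Fin.val_succ, Fin.val_castSucc]⟩

variable [InnerProductSpace ℝ E]

theorem norm_sub_starProjection_le_norm_add (U : Submodule ℝ E) [U.HasOrthogonalProjection]
    (v : E) {w : E} (hw : w ∈ U) : ‖v - U.starProjection v‖ ≤ ‖v + w‖ := by
  rw [Submodule.starProjection_minimal]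
  have hbdd : BddBelow (Set.range fun x : U => ‖v - x‖) :=
    ⟨0, Set.forall_mem_range.2 fun _ => norm_nonneg _⟩
  simpa using ciInf_le hbdd (-⟨w, hw⟩)

theorem sub_mem_outerSpan_left (q : ℕ → I) {i k l : ℕ} (hk : k < i) (v : I) (r : Fin l → I) :
    f (q (k + 1)) - f (q k) ∈ outerSpan f (fun e : Fin i => q e) (q i) v r := by
  have hsnoc : (Fin.snoc (fun e : Fin i => q e) (q i) : Fin (i + 1) → I) =
      fun e : Fin (i + 1) => q e := by
    funext e
    induction e using Fin.lastCases with
    | last => simp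
    | cast e => simp
  refine Submodule.subset_span (Or.inl ?_)
  rw [hsnoc]
  have hcons : ∀ e : Fin (i + 2), (Fin.cons 0 fun e : Fin (i + 1) => q e : Fin (i + 2) → I) e =
      (fun m : ℕ => m.casesOn 0 q : ℕ → I) e := by
    intro e
    induction e using Fin.cases with
    | zero => rfl
    | succ e => rfl
  exact sub_mem_incrementsAlong hcons (Nat.succ_lt_succ hk)

theorem sub_mem_outerSpan_right (q : ℕ → I) {j k l m : ℕ} (hjk : j ≤ k) (hk : k < j + l) (u : I)
    (s : Fin m → I) :
    f (q (k + 1)) - f (q k) ∈ outerSpan f s u (q j) (fun e : Fin l => q (j + 1 + e)) := by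
  obtain ⟨d, rfl⟩ := Nat.exists_eq_add_of_le hjk
  have hcons : ∀ e : Fin (l + 1), (Fin.cons (q j) fun e : Fin l => q (j + 1 + e) :
      Fin (l + 1) → I) e = q (j + e) := by
    intro e
    induction e using Fin.cases with
    | zero => rfl
    | succ e => simp [add_assoc, add_comm 1]
  exact Submodule.subset_span (Or.inr
    (sub_mem_incrementsAlong (q := fun e => q (j + e)) hcons (Nat.lt_of_add_lt_add_left hk)))

theorem KernelForm.mul_norm_sum_Ico_sq_le [CompleteSpace E] {β : ℝ} (hf : KernelForm f β)
    {q : ℕ → I} {M i j : ℕ} (hq : StrictMonoOn q (Set.Iic M)) (hij : i < j) (hjM : j ≤ M)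
    {c : ℕ → ℝ} (hc : c i ≠ 0) :
    β * ‖∑ k ∈ Finset.Ico i j, c k • (f (q (k + 1)) - f (q k))‖ ^ 2 ≤
      ‖∑ k ∈ Finset.range M, c k • (f (q (k + 1)) - f (q k))‖ ^ 2 := by
  obtain ⟨m, rfl⟩ := Nat.exists_eq_add_of_le hij.le
  obtain ⟨l, rfl⟩ := Nat.exists_eq_add_of_le hjM
  have hlt : ∀ {a b}, a < b → b ≤ i + m + l → q a < q b := fun hab hb =>
    hq (hab.le.trans hb) hb hab
  set U := (outerSpan f (fun e : Fin i => q e) (q i) (q (i + m))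
    fun e : Fin l => q (i + m + 1 + e)).topologicalClosure
  have hinner := hf m i l (fun e => c (i + e)) (fun e => q (i + e)) (fun e => q e)
    (fun e => q (i + m + 1 + e)) (fun h => hc (congrFun h ⟨0, by omega⟩))
    (fun a b hab => hlt (by simpa using hab) (by omega))
    (fun a b hab => hlt (by simpa using hab) (by omega))
    (fun a b hab => hlt (by simpa using hab) (by omega))
    (fun a => hlt a.2 (by simp [add_assoc]))
    (fun a => hlt (by simp only [Fin.val_last]; omega) (by omega))
  have hblock : ∑ e : Fin m, c (i + e) • (f (q (i + e.succ)) - f (q (i + e.castSucc))) =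
      ∑ k ∈ Finset.Ico i (i + m), c k • (f (q (k + 1)) - f (q k)) := by
    rw [Finset.sum_Ico_eq_sum_range, Nat.add_sub_cancel_left, Finset.sum_range]
    rfl
  have houter : ∑ k ∈ Finset.range i, c k • (f (q (k + 1)) - f (q k)) +
      ∑ k ∈ Finset.Ico (i + m) (i + m + l), c k • (f (q (k + 1)) - f (q k)) ∈ U := by
    refine U.add_mem (U.sum_mem fun k hk => U.smul_mem _ (Submodule.le_topologicalClosure _ ?_))
      (U.sum_mem fun k hk => U.smul_mem _ (Submodule.le_topologicalClosure _ ?_))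
    · exact sub_mem_outerSpan_left q (Finset.mem_range.1 hk) _ _
    · exact sub_mem_outerSpan_right q (Finset.mem_Ico.1 hk).1 (Finset.mem_Ico.1 hk).2 _ _
  rw [hblock] at hinner
  refine hinner.le.trans (pow_le_pow_left₀ (norm_nonneg _) ?_ 2)
  refine (norm_sub_starProjection_le_norm_add U _ houter).trans_eq ?_
  rw [← Finset.sum_range_add_sum_Ico _ hjM, ← Finset.sum_range_add_sum_Ico _ hij.le]
  congr 1
  abel

theorem sq_mul_norm_sum_sq_le_norm_sum_smul_sq {ι : Type*} {s : Finset ι} {Δ : ι → E} {c : ι → ℝ}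
    {m : ℝ} (hm : 0 ≤ m) (hc : ∀ k ∈ s, m ≤ c k) (hΔ : ∀ k ∈ s, 0 ≤ inner ℝ (Δ k) (∑ l ∈ s, Δ l)) :
    m ^ 2 * ‖∑ k ∈ s, Δ k‖ ^ 2 ≤ ‖∑ k ∈ s, c k • Δ k‖ ^ 2 := by
  set V := ∑ k ∈ s, Δ k with hV
  set R := ∑ k ∈ s, (c k - m) • Δ k with hR
  have hsplit : ∑ k ∈ s, c k • Δ k = R + m • V := by
    rw [hR, hV, Finset.smul_sum, ← Finset.sum_add_distrib]
    exact Finset.sum_congr rfl fun k _ => by rw [← add_smul, sub_add_cancel]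
  have hinner : 0 ≤ inner ℝ R V := by
    rw [hR, sum_inner]
    refine Finset.sum_nonneg fun k hk => ?_
    rw [real_inner_smul_left]
    exact mul_nonneg (sub_nonneg.2 (hc k hk)) (hΔ k hk)
  calc m ^ 2 * ‖V‖ ^ 2 = ‖m • V‖ ^ 2 := by rw [norm_smul, mul_pow, Real.norm_eq_abs, sq_abs]
    _ ≤ ‖R‖ ^ 2 + 2 * (m * inner ℝ R V) + ‖m • V‖ ^ 2 := by
      linarith [sq_nonneg ‖R‖, mul_nonneg hm hinner]
    _ = ‖R + m • V‖ ^ 2 := by rw [norm_add_sq_real, real_inner_smul_right]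
    _ = ‖∑ k ∈ s, c k • Δ k‖ ^ 2 := by rw [hsplit]

theorem NonnegRowSum.sq_mul_norm_sub_sq_le (hrow : NonnegRowSum f) {q : ℕ → I} (hq : Monotone q)
    {i j : ℕ} (hij : i ≤ j) {c : ℕ → ℝ} {m : ℝ} (hm : 0 ≤ m) (hc : ∀ k ∈ Finset.Ico i j, m ≤ c k) :
    m ^ 2 * ‖f (q j) - f (q i)‖ ^ 2 ≤
      ‖∑ k ∈ Finset.Ico i j, c k • (f (q (k + 1)) - f (q k))‖ ^ 2 := by
  have htelescope : ∑ k ∈ Finset.Ico i j, (f (q (k + 1)) - f (q k)) = f (q j) - f (q i) :=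
    Finset.sum_Ico_sub (fun k => f (q k)) hij
  rw [← htelescope]
  refine sq_mul_norm_sum_sq_le_norm_sum_smul_sq hm hc fun k hk => ?_
  obtain ⟨hik, hkj⟩ := Finset.mem_Ico.1 hk
  rw [htelescope]
  exact hrow _ _ _ _ (hq hik) (hq k.le_succ) (hq hkj)

theorem KernelForm.mul_norm_sub_sq_le_of_tendsto [CompleteSpace E] {β : ℝ} (hf : KernelForm f β)
    (hβ : 0 ≤ β) (hrow : NonnegRowSum f) (hfc : Continuous f) {g : I → ℝ} {a b : I} (hab : a < b)
    {m : ℝ} (hm : 0 < m) (hg : ∀ u ∈ Set.Icc a b, m ≤ g u) {Z : E}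
    (hZ : Tendsto (dyadicSum g f) atTop (𝓝 Z)) :
    β * (m ^ 2 * ‖f b - f a‖ ^ 2) ≤ ‖Z‖ ^ 2 := by
  obtain ⟨i, j, hdyadic, hi, hj⟩ := exists_dyadicPoint_tendsto hab
  have hlim := ((((hfc.tendsto b).comp hj).sub ((hfc.tendsto a).comp hi)).norm.pow 2).const_mul
    (m ^ 2) |>.const_mul β
  refine le_of_tendsto_of_tendsto hlim (hZ.norm.pow 2) ?_
  filter_upwards [hdyadic] with n hn
  obtain ⟨hij, hj_le, ha_le, hle_b⟩ := hn
  have hmono := monotone_dyadicPoint n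
  have hgm : ∀ k ∈ Finset.Ico (i n) (j n), m ≤ g (dyadicPoint n k) := fun k hk =>
    hg _ ⟨ha_le.trans (hmono (Finset.mem_Ico.1 hk).1),
      (hmono (Finset.mem_Ico.1 hk).2.le).trans hle_b⟩
  have hgi : g (dyadicPoint n (i n)) ≠ 0 :=
    (hm.trans_le (hgm _ (Finset.left_mem_Ico.2 hij))).ne'
  exact (mul_le_mul_of_nonneg_left (hrow.sq_mul_norm_sub_sq_le hmono hij.le hm.le hgm) hβ).trans
    (hf.mul_norm_sum_Ico_sq_le (strictMonoOn_dyadicPoint n) hij hj_le hgi)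

theorem forall_half_le_or_exists_Icc_half_le {g : I → ℝ} {L τ : ℝ≥0} (hg : HolderWith L τ g)
    (hL : L ≠ 0) (hτ : 0 < τ) {r : I} (hr : 0 < g r) :
    (∀ u, g r / 2 ≤ g u) ∨
      ∃ a b : I, a < b ∧ (g r / (2 * L)) ^ (1 / (τ : ℝ)) ≤ (b : ℝ) - a ∧
        ∀ u ∈ Set.Icc a b, g r / 2 ≤ g u := by
  have : (0 : ℝ) < L := NNReal.coe_pos.2 (pos_iff_ne_zero.2 hL)
  have hτ' : (0 : ℝ) < τ := NNReal.coe_pos.2 hτ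
  set ℓ := (g r / (2 * L)) ^ (1 / (τ : ℝ)) with hℓ
  have hℓ_pos : 0 < ℓ := by positivity
  have hnear : ∀ w, dist w r ≤ ℓ → g r / 2 ≤ g w := by
    intro w hw
    have hdist : dist (g w) (g r) ≤ g r / 2 := by
      refine (hg.dist_le_of_le hw).trans_eq ?_
      rw [hℓ, ← Real.rpow_mul (by positivity), one_div_mul_cancel hτ'.ne', Real.rpow_one]
      field_simp
    linarith [(abs_le.1 hdist).1]
  refine or_iff_not_imp_left.2 fun hall => ?_
  obtain ⟨u, hu⟩ := not_forall.1 hall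
  have hfar : ℓ ≤ dist u r := le_of_lt (not_le.1 fun h => hu (hnear u h))
  obtain ⟨c, hc⟩ : ∃ c : I, dist c r = ℓ :=
    mem_range_of_exists_le_of_exists_ge (f := fun c : I => dist c r) (by fun_prop)
      ⟨r, by rw [dist_self]; exact hℓ_pos.le⟩ ⟨u, hfar⟩
  have hrc : r ≠ c := fun h => hℓ_pos.ne (by rw [← hc, h, dist_self])
  refine ⟨r ⊓ c, r ⊔ c, inf_lt_sup.2 hrc, ?_, fun w hw => hnear w ?_⟩
  · rw [← hc, Subtype.dist_eq, Real.dist_eq]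
    exact (max_sub_min_eq_abs (r : ℝ) c).ge
  · rw [← hc, dist_comm, dist_comm c]
    exact Real.dist_left_le_of_mem_uIcc (x := (r : ℝ)) (y := w) (z := c) hw

theorem KernelForm.interpolation_of_pos [CompleteSpace E] {β : ℝ} (hf : KernelForm f β)
    (hβ : 0 ≤ β) (hrow : NonnegRowSum f) (hfc : Continuous f) {g : I → ℝ} {L τ : ℝ≥0}
    (hg : HolderWith L τ g) (hL : L ≠ 0) (hτ : 0 < τ) {Z : E}
    (hZ : Tendsto (dyadicSum g f) atTop (𝓝 Z)) {r : I} (hr : 0 < g r) :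
    β / 4 * g r ^ 2 * ‖f 1 - f 0‖ ^ 2 ≤ ‖Z‖ ^ 2 ∨
      ∃ a b : I, a ≤ b ∧ (g r / (2 * L)) ^ (1 / (τ : ℝ)) ≤ (b : ℝ) - a ∧
        β / 4 * g r ^ 2 * ‖f b - f a‖ ^ 2 ≤ ‖Z‖ ^ 2 := by
  have hbound : ∀ {a b : I}, a < b → (∀ u ∈ Set.Icc a b, g r / 2 ≤ g u) →
      β / 4 * g r ^ 2 * ‖f b - f a‖ ^ 2 ≤ ‖Z‖ ^ 2 := fun hab hle => by
    convert hf.mul_norm_sub_sq_le_of_tendsto hβ hrow hfc hab (half_pos hr) hle hZ using 1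
    ring
  rcases forall_half_le_or_exists_Icc_half_le hg hL hτ hr with hall | ⟨a, b, hab, hlen, hle⟩
  · exact Or.inl (hbound zero_lt_one fun u _ => hall u)
  · exact Or.inr ⟨a, b, hab.le, hlen, hbound hab hle⟩

theorem dyadicSum_neg (g : I → ℝ) (f : I → E) : dyadicSum (-g) f = -dyadicSum g f := by
  funext n
  simp [dyadicSum]

theorem KernelForm.interpolation [CompleteSpace E] {β : ℝ} (hf : KernelForm f β)
    (hβ : 0 ≤ β) (hrow : NonnegRowSum f) (hfc : Continuous f) {g : I → ℝ} {L τ : ℝ≥0}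
    (hg : HolderWith L τ g) (hL : L ≠ 0) (hτ : 0 < τ) {Z : E}
    (hZ : Tendsto (dyadicSum g f) atTop (𝓝 Z)) :
    β / 4 * (⨆ r, |g r|) ^ 2 * ‖f 1 - f 0‖ ^ 2 ≤ ‖Z‖ ^ 2 ∨
      ∃ a b : I, a ≤ b ∧ ((⨆ r, |g r|) / (2 * L)) ^ (1 / (τ : ℝ)) ≤ (b : ℝ) - a ∧
        β / 4 * (⨆ r, |g r|) ^ 2 * ‖f b - f a‖ ^ 2 ≤ ‖Z‖ ^ 2 := by
  obtain ⟨r, -, hr⟩ := isCompact_univ.exists_sSup_image_eq Set.univ_nonempty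
    (hg.continuous hτ).abs.continuousOn
  rw [Set.image_univ] at hr
  rw [iSup, hr]
  rcases lt_trichotomy (g r) 0 with hneg | hzero | hpos
  · have hg' : HolderWith L τ (-g) := fun s t => by
      simpa only [Pi.neg_apply, edist_neg_neg] using hg s t
    have hZ' : Tendsto (dyadicSum (-g) f) atTop (𝓝 (-Z)) := by
      rw [dyadicSum_neg]
      exact hZ.neg
    have := hf.interpolation_of_pos hβ hrow hfc hg' hL hτ hZ' (neg_pos.2 hneg)
    rwa [norm_neg, Pi.neg_apply, ← abs_of_neg hneg] at this
  · left
    simp [hzero]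
  · rw [abs_of_pos hpos]
    exact hf.interpolation_of_pos hβ hrow hfc hg hL hτ hZ hpos

end Kernel

/-! ### Processes with a covariance proportional to the Gram matrix of a path -/

section Covariance

theorem norm_sub_sq_le_of_holderWith {E : Type*} [SeminormedAddCommGroup E] {f : I → E}
    {C α : ℝ≥0} (hf : HolderWith C α f) {s t : I} (hst : s ≤ t) :
    ‖f t - f s‖ ^ 2 ≤ C ^ 2 * ((t : ℝ) - s) ^ (2 * (α : ℝ)) := by
  have hlen : dist t s = (t : ℝ) - s := by
    rw [Subtype.dist_eq, Real.dist_eq, abs_of_nonneg (sub_nonneg.2 (Subtype.coe_le_coe.2 hst))]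
  rw [← hlen, ← dist_eq_norm, mul_comm 2, Real.rpow_mul dist_nonneg, Real.rpow_two, ← mul_pow]
  exact pow_le_pow_left₀ dist_nonneg (hf.dist_le t s) 2

section InnerProduct

variable {E F : Type*} [NormedAddCommGroup E] [InnerProductSpace ℝ E] [NormedAddCommGroup F]
  [InnerProductSpace ℝ F] {ι : Type*} {κ : ℝ≥0} {f : ι → E} {Y : ι → F}

theorem inner_sub_sub_eq_mul (hY : ∀ s t, inner ℝ (Y s) (Y t) = κ * inner ℝ (f s) (f t))
    (s t u v : ι) :
    inner ℝ (Y t - Y s) (Y v - Y u) = κ * inner ℝ (f t - f s) (f v - f u) := by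
  simp only [inner_sub_left, inner_sub_right, hY]
  ring

theorem norm_sub_sq_eq_mul (hY : ∀ s t, inner ℝ (Y s) (Y t) = κ * inner ℝ (f s) (f t))
    (s t : ι) : ‖Y t - Y s‖ ^ 2 = κ * ‖f t - f s‖ ^ 2 := by
  rw [← real_inner_self_eq_norm_sq, ← real_inner_self_eq_norm_sq, inner_sub_sub_eq_mul hY]

theorem norm_sum_smul_sq_eq_mul (hY : ∀ s t, inner ℝ (Y s) (Y t) = κ * inner ℝ (f s) (f t))
    (s : Finset ι) (c : ι → ℝ) : ‖∑ k ∈ s, c k • Y k‖ ^ 2 = κ * ‖∑ k ∈ s, c k • f k‖ ^ 2 := by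
  simp only [← real_inner_self_eq_norm_sq, sum_inner, inner_sum, real_inner_smul_left,
    real_inner_smul_right, hY, Finset.mul_sum]
  exact Finset.sum_congr rfl fun k _ => Finset.sum_congr rfl fun l _ => by ring

theorem norm_dyadicSum_sq_eq_mul {f : I → E} {Y : I → F}
    (hY : ∀ s t, inner ℝ (Y s) (Y t) = κ * inner ℝ (f s) (f t)) (g : I → ℝ) (n : ℕ) :
    ‖dyadicSum g Y n‖ ^ 2 = κ * ‖dyadicSum g f n‖ ^ 2 :=
  norm_sum_smul_sq_eq_mul (fun _ _ => inner_sub_sub_eq_mul hY _ _ _ _) _ _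

theorem holderWith_of_inner_eq_mul [PseudoEMetricSpace ι] {C α : ℝ≥0}
    (hY : ∀ s t, inner ℝ (Y s) (Y t) = κ * inner ℝ (f s) (f t)) (hf : HolderWith C α f) :
    HolderWith (NNReal.sqrt κ * C) α Y := by
  intro s t
  have hnorm : ‖Y s - Y t‖₊ = NNReal.sqrt κ * ‖f s - f t‖₊ := by
    rw [← NNReal.sqrt_sq ‖Y s - Y t‖₊, ← NNReal.sqrt_sq ‖f s - f t‖₊, ← NNReal.sqrt_mul]
    congr 1
    exact NNReal.eq (norm_sub_sq_eq_mul hY t s)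
  rw [edist_eq_enorm_sub, enorm_eq_nnnorm, hnorm, ENNReal.coe_mul, ENNReal.coe_mul, mul_assoc,
    ← enorm_eq_nnnorm, ← edist_eq_enorm_sub]
  gcongr
  exact hf s t

end InnerProduct

variable {Ω : Type*} [MeasurableSpace Ω] {P : Measure Ω} {X : I → Ω → ℝ}

theorem coeFn_dyadicSum_toLp (hX : ∀ t, MemLp (X t) 2 P) (g : I → ℝ) (n : ℕ) :
    (dyadicSum g (fun t => (hX t).toLp (X t)) n : Lp ℝ 2 P) =ᵐ[P]
      fun ω => dyadicSum g (fun t => X t ω) n := by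
  have hterm : ∀ c : ℝ, ∀ s t : I, ∀ᵐ ω ∂P, (c • ((hX t).toLp (X t) - (hX s).toLp (X s))) ω =
      c • (X t ω - X s ω) := fun c s t => by
    filter_upwards [Lp.coeFn_smul c ((hX t).toLp (X t) - (hX s).toLp (X s)),
      Lp.coeFn_sub ((hX t).toLp (X t)) ((hX s).toLp (X s)), (hX t).coeFn_toLp, (hX s).coeFn_toLp]
      with ω hsmul hsub ht hs
    rw [hsmul, Pi.smul_apply, hsub, Pi.sub_apply, ht, hs]
  filter_upwards [Lp.coeFn_fun_finsetSum (Finset.range (2 ^ n)) fun k =>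
      g (dyadicPoint n k) • ((hX (dyadicPoint n (k + 1))).toLp (X (dyadicPoint n (k + 1))) -
        (hX (dyadicPoint n k)).toLp (X (dyadicPoint n k))),
    ae_all_iff.2 fun k => hterm (g (dyadicPoint n k)) (dyadicPoint n k) (dyadicPoint n (k + 1))]
    with ω hsum hω
  rw [dyadicSum, hsum]
  exact Finset.sum_congr rfl fun k _ => hω k

theorem ae_eq_youngIntegral_of_tendsto_dyadicSum (hX : ∀ t, MemLp (X t) 2 P) {g : I → ℝ}
    (hyoung : ∀ᵐ ω ∂P, HasYoungIntegral g (fun t => X t ω) (youngIntegral g fun t => X t ω))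
    {V : Lp ℝ 2 P} (hV : Tendsto (dyadicSum g fun t => (hX t).toLp (X t)) atTop (𝓝 V)) :
    V =ᵐ[P] fun ω => youngIntegral g fun t => X t ω := by
  obtain ⟨φ, hφ, hlim⟩ := (tendstoInMeasure_of_tendsto_Lp hV).exists_seq_tendsto_ae
  filter_upwards [hlim, hyoung, ae_all_iff.2 fun n => coeFn_dyadicSum_toLp hX g n]
    with ω hlim hyoung hsum
  refine tendsto_nhds_unique hlim ?_
  simp only [hsum]
  exact hyoung.tendsto_dyadicSum.comp hφ.tendsto_atTop

variable {E : Type*} [NormedAddCommGroup E] [InnerProductSpace ℝ E] {κ : ℝ≥0} {f : I → E}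
  {C α L τ : ℝ≥0} {g : I → ℝ}

theorem integral_sub_sq_eq_mul (hX : ∀ t, MemLp (X t) 2 P)
    (hcov : ∀ s t, ∫ ω, X s ω * X t ω ∂P = κ * inner ℝ (f s) (f t)) (s t : I) :
    ∫ ω, (X t ω - X s ω) ^ 2 ∂P = κ * ‖f t - f s‖ ^ 2 := by
  rw [← norm_sub_sq_eq_mul (Y := fun t => (hX t).toLp (X t))
    (fun s t => (inner_toLp_toLp _ _).trans (hcov s t)), ← MemLp.toLp_sub,
    ← real_inner_self_eq_norm_sq, inner_toLp_toLp]
  simp only [Pi.sub_apply, sq]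

theorem ae_hasYoungIntegral_youngIntegral_of_covariance (hX : ∀ t, MemLp (X t) 2 P)
    (hcov : ∀ s t, ∫ ω, X s ω * X t ω ∂P = κ * inner ℝ (f s) (f t))
    (hcont : ∀ᵐ ω ∂P, Continuous fun t => X t ω) (hα : 1 / 2 < (α : ℝ)) (hf : HolderWith C α f)
    (hg : HolderWith L τ g) (hτα : 1 < (τ : ℝ) + α) :
    ∀ᵐ ω ∂P, HasYoungIntegral g (fun t => X t ω) (youngIntegral g fun t => X t ω) := by
  refine ae_hasYoungIntegral_youngIntegral (K := κ * C ^ 2) (θ := 2 * α)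
    (fun s t => by simpa using ((hX t).sub (hX s)).integrable_norm_pow two_ne_zero)
    (fun s t hst => ?_) hcont (by linarith) hg (by linarith)
  simp only [Real.norm_eq_abs, sq_abs]
  rw [integral_sub_sq_eq_mul hX hcov, mul_assoc]
  exact mul_le_mul_of_nonneg_left (norm_sub_sq_le_of_holderWith hf hst.le) κ.2

theorem exists_tendsto_dyadicSum_and_integral_youngIntegral_sq [CompleteSpace E]
    (hX : ∀ t, MemLp (X t) 2 P)
    (hcov : ∀ s t, ∫ ω, X s ω * X t ω ∂P = κ * inner ℝ (f s) (f t))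
    (hyoung : ∀ᵐ ω ∂P, HasYoungIntegral g (fun t => X t ω) (youngIntegral g fun t => X t ω))
    (hf : HolderWith C α f) (hg : HolderWith L τ g) (hτα : 1 < τ + α) :
    ∃ Z, Tendsto (dyadicSum g f) atTop (𝓝 Z) ∧
      MemLp (fun ω => youngIntegral g fun t => X t ω) 2 P ∧
      ∫ ω, (youngIntegral g fun t => X t ω) ^ 2 ∂P = κ * ‖Z‖ ^ 2 := by
  have hY : ∀ s t, inner ℝ ((hX s).toLp (X s)) ((hX t).toLp (X t)) = κ * inner ℝ (f s) (f t) :=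
    fun s t => (inner_toLp_toLp _ _).trans (hcov s t)
  obtain ⟨Z, hZ⟩ := cauchySeq_tendsto_of_complete (cauchySeq_dyadicSum hg hf hτα)
  obtain ⟨V, hV⟩ := cauchySeq_tendsto_of_complete
    (cauchySeq_dyadicSum hg (holderWith_of_inner_eq_mul hY hf) hτα)
  have hVJ := ae_eq_youngIntegral_of_tendsto_dyadicSum hX hyoung hV
  have hJ := (Lp.memLp V).ae_eq hVJ
  refine ⟨Z, hZ, hJ, ?_⟩
  have hVZ : ‖V‖ ^ 2 = κ * ‖Z‖ ^ 2 := by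
    refine tendsto_nhds_unique (hV.norm.pow 2) ?_
    simp only [norm_dyadicSum_sq_eq_mul hY]
    exact (hZ.norm.pow 2).const_mul _
  have hJV : hJ.toLp _ = V := Lp.ext (hJ.coeFn_toLp.trans hVJ.symm)
  rw [← hVZ, ← hJV, ← real_inner_self_eq_norm_sq, inner_toLp_toLp]
  simp only [sq]

end Covariance

theorem mainTheorem3_general {E : Type*} [NormedAddCommGroup E] [InnerProductSpace ℝ E]
    [CompleteSpace E] {Ω : Type*} [MeasurableSpace Ω] {P : Measure Ω} {f : I → E}
    {X : I → Ω → ℝ} {κ : ℝ≥0} (hX : ∀ t, MemLp (X t) 2 P)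
    (hcov : ∀ s t, ∫ ω, X s ω * X t ω ∂P = κ * inner ℝ (f s) (f t))
    (hXcont : ∀ᵐ ω ∂P, Continuous fun t => X t ω) (hf0 : f 0 = 0) {C α : ℝ≥0}
    (hα : 1 / 2 < (α : ℝ)) (hf : HolderWith C α f) {β : ℝ} (hβ : 0 ≤ β) (hker : KernelForm f β)
    (hrow : NonnegRowSum f) {τ : ℝ≥0} (hτ : 0 < τ) (hτα : 1 < (τ : ℝ) + α) {g : I → ℝ}
    (hg : MemHolder τ g) (hg0 : nnHolderNorm τ g ≠ 0) :
    (∀ᵐ ω ∂P, HasYoungIntegral g (fun t => X t ω) (youngIntegral g fun t => X t ω)) ∧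
    MemLp (fun ω => youngIntegral g fun t => X t ω) 2 P ∧
    (β / 4 * (⨆ r, |g r|) ^ 2 * ∫ ω, X 1 ω ^ 2 ∂P
        ≤ ∫ ω, (youngIntegral g fun t => X t ω) ^ 2 ∂P ∨
      ∃ a b : I, a ≤ b ∧
        ((⨆ r, |g r|) / (2 * (nnHolderNorm τ g : ℝ))) ^ (1 / (τ : ℝ)) ≤ (b : ℝ) - a ∧
        β / 4 * (⨆ r, |g r|) ^ 2 * ∫ ω, (X b ω - X a ω) ^ 2 ∂P
          ≤ ∫ ω, (youngIntegral g fun t => X t ω) ^ 2 ∂P) := by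
  have hyoung := ae_hasYoungIntegral_youngIntegral_of_covariance hX hcov hXcont hα hf
    hg.holderWith hτα
  obtain ⟨Z, hZ, hmem, hmoment⟩ := exists_tendsto_dyadicSum_and_integral_youngIntegral_sq hX hcov
    hyoung hf hg.holderWith (by exact_mod_cast hτα)
  refine ⟨hyoung, hmem, ?_⟩
  have hX1 : ∫ ω, X 1 ω ^ 2 ∂P = κ * ‖f 1 - f 0‖ ^ 2 := by
    simp only [sq (X 1 _), hcov, hf0, sub_zero, real_inner_self_eq_norm_sq]
  have hscale : ∀ {y : ℝ}, β / 4 * (⨆ r, |g r|) ^ 2 * y ≤ ‖Z‖ ^ 2 →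
      β / 4 * (⨆ r, |g r|) ^ 2 * (κ * y) ≤ κ * ‖Z‖ ^ 2 := fun hy => by
    rw [mul_left_comm]
    exact mul_le_mul_of_nonneg_left hy κ.2
  have hα0 : 0 < α := NNReal.coe_pos.1 (by linarith)
  rw [hmoment, hX1]
  simp only [integral_sub_sq_eq_mul hX hcov]
  refine (hker.interpolation hβ hrow (hf.continuous hα0) hg.holderWith hg0 hτ hZ).imp hscale ?_
  rintro ⟨a, b, hab, hlen, h⟩
  exact ⟨a, b, hab, hlen, hscale h⟩

end

theorem mainTheorem3
    {H : Type*} [NormedAddCommGroup H] [InnerProductSpace ℝ H] [CompleteSpace H]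
    [TopologicalSpace.SeparableSpace H]
    {Ω : Type*} [MeasurableSpace Ω] (P : Measure Ω) [IsProbabilityMeasure P]
    (W : H → Ω → ℝ) (hW : IsIsonormalGaussian W P)
    (n : ℕ) (hn : 1 ≤ n)
    (f : I → HilbertTensorPower H n) (X : I → Ω → ℝ)
    (hX : ∀ t, IsMultipleIntegral W P n (f t) (X t))
    (hXcont : ∀ᵐ ω ∂P, Continuous fun t => X t ω)
    (θ : ℝ) (hreg : KernelRegularity f θ)
    (β : ℝ) (hβ0 : 0 < β) (hβ1 : β < 1) (hker : KernelForm f β)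
    (hrow : NonnegRowSum f)
    (ρ : ℝ) (hρ : ρ < θ / 2)
    (τ : ℝ≥0) (hτ : 0 < τ) (hτρ : 1 < (τ : ℝ) + ρ)
    (g : I → ℝ) (hg : MemHolder τ g) (hg0 : nnHolderNorm τ g ≠ 0) :
    (∀ᵐ ω ∂P, HasYoungIntegral g (fun t => X t ω) (youngIntegral g fun t => X t ω)) ∧
    MemLp (fun ω => youngIntegral g fun t => X t ω) 2 P ∧
    (β / 4 * (⨆ r, |g r|) ^ 2 * ∫ ω, X 1 ω ^ 2 ∂P
        ≤ ∫ ω, (youngIntegral g fun t => X t ω) ^ 2 ∂P ∨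
      ∃ a b : I, a ≤ b ∧
        ((⨆ r, |g r|) / (2 * (nnHolderNorm τ g : ℝ))) ^ (1 / (τ : ℝ)) ≤ (b : ℝ) - a ∧
        β / 4 * (⨆ r, |g r|) ^ 2 * ∫ ω, (X b ω - X a ω) ^ 2 ∂P
          ≤ ∫ ω, (youngIntegral g fun t => X t ω) ^ 2 ∂P) := by
  obtain ⟨C, α, hα, hf⟩ := hreg.exists_holderWith
  exact mainTheorem3_general (κ := n.factorial) (fun t => (hX t).choose)
    (fun s t => by simpa using (hX s).integral_mul hW (hX t)) hXcont hreg.2.1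
    (by linarith [hreg.1]) hf hβ0.le hker hrow hτ (by linarith) hg hg0
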